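/- **Model.** There are $n$ parties, at most $f$ of them Byzantine and the others honest. Parties sign messages, and Byzantine parties (who may collude) cannot forge signatures of honest parties. The protocols are deterministic: what a party does at a local time depends on its input and on the messages it has received so far, with their local receipt times. Each party has a local clock without drift that starts at $0$ when the party starts. A message arriving before its recipient starts is received when the recipient starts. A party's own messages are known to it at once. $\Delta>0$ is a known bound on the message delays between honest parties. In a given execution these delays lie in $[0,\delta]$, where the actual bound $\delta\le\Delta$ is unknown to the parties, and honest parties start at most $\delta$ apart (unsynchronized start). Delays from and to Byzantine parties are arbitrary. Executions are causal: no circular or infinite backward chains of messages. A protocol with designated broadcaster $L$, whose input is a value $v\in V$, *solves Byzantine broadcast* if in all executions: (Agreement) no two commits of honest parties differ; (Validity) if $L$ is honest, all honest parties commit its value and terminate; (Termination) all honest parties commit a value (in $V\cup\{\bot\}$) and terminate. In *Byzantine reliable broadcast* termination is only required if some honest party commits and terminates. The protocol has *good-case latency* $T$ if, whenever $L$ is honest, all honest parties commit within time $T$ after $L$ starts. A *Byzantine agreement* (BA) protocol gives every party an input; all honest parties commit and terminate, their commits agree, and they equal the common input if all honest parties have the same input. **The $(\Delta+\delta)$-$n/3$-BB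 protocol.** Put $\sigma=\Delta$. Every party $i$ starts with $\mathrm{lock}=\bot$. 1. *Propose.* $L$ with input $v$ sends $\langle \mathrm{propose},v\rangle_L$ to all parties. 2. *Vote.* On receiving the first valid proposal $\langle \mathrm{propose},v\rangle_L$ from $L$, party $i$ sends $\langle\mathrm{vote},\langle\mathrm{propose},v\rangle_L\rangle_i$ to all parties and starts a vote timer of length $\Delta$. 3. *Commit.* If $i$ has detected no equivocation (two different proposals signed by $L$, possibly inside other messages) up to and including the moment when its timer expires, then from that moment on: when it has votes of $n-f$ parties for the value $v$ that it voted for (checked when the timer expires and whenever a vote for $v$ arrives), it forwards these votes to all parties, and if its local time is then at most $2\Delta+\sigma$ it commits $v$, sets $\mathrm{lock}=v$ and sends $\langle\mathrm{commit},v\rangle_i$ to all parties. 4. *Lock and agree.* At local time $3\Delta+2\sigma$: if $i$ has $n-f$ votes for exactly one value $v$, it sets $\mathrm{lock}=v$. Otherwise, if it has $n-f$ votes for two different values, let $F$ be the intersection of the two sets of voters; if $i$ has received $\langle\mathrm{commit},u\rangle_j$ signed by some $j\notin F$, it sets $\mathrm{lock}=u$, and commits $u$ if it has not committed. Then it invokes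 an instance of a BA protocol with input $\mathrm{lock}$, commits the output if it has not committed, and terminates when the BA instance does. **Theorem.** Let $\Delta>0$, $3f\le n$, let $L$ be any party and $V$ any set of values. For every BA protocol for inputs in $V\cup\{\bot\}$ that tolerates $f$ faults, message delays up to $\Delta$ and clock skew up to $\Delta$: (a) the $(\Delta+\delta)$-$n/3$-BB protocol built on it solves Byzantine broadcast with at most $f$ faults in the synchronous authenticated model with unsynchronized start; (b) it has good-case latency $\Delta+\delta$: for every $0\le\delta\le\Delta$, in every execution with actual delay bound $\delta$, clock skew at most $\delta$ and honest $L$, all honest parties commit within time $\Delta+\delta$ after $L$ starts. (c) This is optimal for $f=n/3$: if $n=3f$ and $V$ has at least two elements, and $Q$ is any deterministic authenticated protocol that solves Byzantine reliable broadcast (in particular, any that solves Byzantine broadcast) with $f$ faults and delay bound $\Delta$, even only under synchronized start, then for every $0<\delta\le\Delta$, if in all executions of $Q$ with synchronized start, delays at most $\delta$ and honest $L$ all honest parties commit within time $T$ after $L$ starts, then $T\ge\Delta+\delta$. -/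

import Mathlib

noncomputable section

namespace GoodCase

/-! ## Signed messages -/

/-- Messages exchanged by `n` parties, with atoms in `D`; `sign i m` is the message `m`
signed by party `i`. -/
inductive Term (n : ℕ) (D : Type*) where
  | data : D → Term n D
  | pair : Term n D → Term n D → Term n D
  | sign : Fin n → Term n D → Term n D

namespace Term

/-- All signatures occurring in a message: `(i, u) ∈ sigs m` iff `sign i u` is a part of `m`. -/
def sigs {n : ℕ} {D : Type*} : Term n D → Set (Fin n × Term n D)
  | data _ => ∅
  | pair a b => a.sigs ∪ b.sigs
  | sign i a => insert (i, a) a.sigs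

/-- Renaming of atoms. -/
def map {n : ℕ} {D D' : Type*} (g : D → D') : Term n D → Term n D'
  | data d => data (g d)
  | pair a b => pair (a.map g) (b.map g)
  | sign i a => sign i (a.map g)

theorem mem_sigs_map {n : ℕ} {D D' : Type*} (g : D → D') (m : Term n D) (k : Fin n)
    (u : Term n D') :
    (k, u) ∈ (m.map g).sigs ↔ ∃ u', (k, u') ∈ m.sigs ∧ u = u'.map g := by
  induction m with
  | data d => simp [map, sigs]
  | pair a b iha ihb =>
    simp only [map, sigs, Set.mem_union, iha, ihb]
    constructor
    · rintro (⟨u', h, rfl⟩ | ⟨u', h, rfl⟩)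
      · exact ⟨u', Or.inl h, rfl⟩
      · exact ⟨u', Or.inr h, rfl⟩
    · rintro ⟨u', h | h, rfl⟩
      · exact Or.inl ⟨u', h, rfl⟩
      · exact Or.inr ⟨u', h, rfl⟩
  | sign i a iha =>
    simp only [map, sigs, Set.mem_insert_iff, iha, Prod.mk.injEq]
    constructor
    · rintro (⟨rfl, rfl⟩ | ⟨u', h, rfl⟩)
      · exact ⟨a, Or.inl ⟨rfl, rfl⟩, rfl⟩
      · exact ⟨u', Or.inr h, rfl⟩
    · rintro ⟨u', ⟨rfl, rfl⟩ | h, rfl⟩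
      · exact Or.inl ⟨rfl, rfl⟩
      · exact Or.inr ⟨u', h, rfl⟩

end Term

/-! ## Protocols and executions -/

/-- What a party has received: `(t, j, m)` says that message `m` was received from party `j`
when the local clock showed `t`. -/
abbrev History (n : ℕ) (D : Type*) := Set (ℝ × Fin n × Term n D)

/-- The part of a history that is known at local time `t`. -/
def History.upTo {n : ℕ} {D : Type*} (H : History n D) (t : ℝ) : History n D :=
  {e | e ∈ H ∧ e.1 ≤ t}

/-- A deterministic authenticated protocol for `n` parties with inputs in `I` and outputs
in `O`. What party `i` does at local time `t` is a function of its input and of the messages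
it has received up to and including local time `t` (the `History` argument):
* `send i x H t j` is the set of messages it sends to party `j ≠ i` at local time `t`
  (messages to itself are part of its own local computation);
* `commit i x H t = some o` says that it commits the value `o` at local time `t`;
* `halt i x H t` says that it terminates at local time `t`.
By `authentic`, it can produce its own signatures only; every other signature it sends
is copied from a received message. -/
structure Protocol (n : ℕ) (D I O : Type*) where
  send : Fin n → I → History n D → ℝ → Fin n → Set (Term n D)
  commit : Fin n → I → History n D → ℝ → Option O
  halt : Fin n → I → History n D → ℝ → Prop
  authentic : ∀ i x H t j m, m ∈ send i x H t j → ∀ k u, (k, u) ∈ m.sigs → k ≠ i →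
    ∃ e ∈ H, (k, u) ∈ e.2.2.sigs

/-- The data of an execution, on a global real time axis: the Byzantine parties, the inputs,
the times at which the parties start, the messages `sent i j s` that `i` sends to `j` at
time `s`, and the network delay `delay i j s m` of each of them. -/
structure Execution (n : ℕ) (D I : Type*) where
  byz : Finset (Fin n)
  input : Fin n → I
  start : Fin n → ℝ
  sent : Fin n → Fin n → ℝ → Set (Term n D)
  delay : Fin n → Fin n → ℝ → Term n D → ℝ

namespace Execution

variable {n : ℕ} {D I O : Type*}

/-- What party `i` has received up to and including global time `t`, on its local clock,
which shows `0` when `i` starts. A message that arrives before `i` starts is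
received when `i` starts. -/
def view (E : Execution n D I) (i : Fin n) (t : ℝ) : History n D :=
  {e | e.2.1 ≠ i ∧ ∃ s, e.2.2 ∈ E.sent e.2.1 i s ∧
    e.1 = max (s + E.delay e.2.1 i s e.2.2) (E.start i) - E.start i ∧ e.1 ≤ t - E.start i}

/-- Party `i`, following `P`, has not terminated before global time `t`. -/
def Active (E : Execution n D I) (P : Protocol n D I O) (i : Fin n) (t : ℝ) : Prop :=
  ∀ t', E.start i ≤ t' → t' < t → ¬ P.halt i (E.input i) (E.view i t') (t' - E.start i)

/-- Party `i`, following `P`, commits `o` at global time `t`. -/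
def Commits (E : Execution n D I) (P : Protocol n D I O) (i : Fin n) (t : ℝ) (o : O) : Prop :=
  E.start i ≤ t ∧ E.Active P i t ∧ P.commit i (E.input i) (E.view i t) (t - E.start i) = some o

/-- Party `i`, following `P`, terminates. -/
def Terminates (E : Execution n D I) (P : Protocol n D I O) (i : Fin n) : Prop :=
  ∃ t, E.start i ≤ t ∧ P.halt i (E.input i) (E.view i t) (t - E.start i)

/-- The place of party `i` in the causal order: every honest party is a place of its own,
and all Byzantine parties together (they collude) are the place `none`. -/
def site (E : Execution n D I) (i : Fin n) : Option (Fin n) :=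
  if i ∈ E.byz then none else some i

/-- What happens at place `x.1` at time `x.2` is directly visible at place `y.1` at time `y.2`:
some message sent there and then has arrived. -/
def Influences (E : Execution n D I) (x y : Option (Fin n) × ℝ) : Prop :=
  ∃ i j m, i ≠ j ∧ ¬ (i ∈ E.byz ∧ j ∈ E.byz) ∧ E.site i = x.1 ∧ E.site j = y.1 ∧
    m ∈ E.sent i j x.2 ∧ x.2 + E.delay i j x.2 m ≤ y.2

/-- `E` is an execution of `P` with at most `f` Byzantine parties, in which all message delays
between honest parties are at most `δ` and honest parties start at most `σ` apart.
* The delay of a message from or to a Byzantine party is any non-negative number (not sending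
  or ignoring a message accounts for an infinite delay).
* Honest parties follow `P` from their start until they terminate.
* Byzantine parties send whatever they like, except that they cannot forge signatures: a
  signature of an honest party in a message that they send at time `s` occurs in some message
  of an honest party that a Byzantine party has received by time `s`.
* Causality: there is no circular or infinite backward chain of messages. -/
structure IsRun (E : Execution n D I) (P : Protocol n D I O) (f : ℕ) (δ σ : ℝ) : Prop where
  faults : E.byz.card ≤ f
  skew : ∀ i j, i ∉ E.byz → j ∉ E.byz → |E.start i - E.start j| ≤ σ
  delay_nonneg : ∀ i j s m, 0 ≤ E.delay i j s m
  delay_le : ∀ i j s m, i ∉ E.byz → j ∉ E.byz → E.delay i j s m ≤ δ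
  honest : ∀ i j s, i ∉ E.byz → i ≠ j → E.sent i j s =
    {m | E.start i ≤ s ∧ E.Active P i s ∧
      m ∈ P.send i (E.input i) (E.view i s) (s - E.start i) j}
  unforgeable : ∀ b j s m, b ∈ E.byz → j ∉ E.byz → m ∈ E.sent b j s →
    ∀ k u, k ∉ E.byz → (k, u) ∈ m.sigs →
      ∃ i b' s' m', i ∉ E.byz ∧ b' ∈ E.byz ∧ m' ∈ E.sent i b' s' ∧
        s' + E.delay i b' s' m' ≤ s ∧ (k, u) ∈ m'.sigs
  causal : WellFounded E.Influences

end Execution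

/-! ## Byzantine broadcast, reliable broadcast, agreement, good-case latency -/

/-- In a broadcast only the broadcaster `L` has an input, the value `v`. -/
def broadcastInput {n : ℕ} {V : Type*} (L : Fin n) (v : V) (i : Fin n) : Option V :=
  if i = L then some v else none

/-- No two commits of honest parties differ. -/
def Agreement {n : ℕ} {D I O : Type*} (P : Protocol n D I O) (E : Execution n D I) : Prop :=
  ∀ i j t t' o o', i ∉ E.byz → j ∉ E.byz → E.Commits P i t o → E.Commits P j t' o' → o = o'

/-- `P` solves Byzantine broadcast of values in `V` with broadcaster `L`, against `f` faults,
for message delays at most `Δ` and clock skew at most `σ`. Parties commit values in `V ∪ {⊥}`,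
where `⊥` is `none`. -/
structure SolvesBB {n : ℕ} {D V : Type*} (P : Protocol n D (Option V) (Option V)) (L : Fin n)
    (f : ℕ) (Δ σ : ℝ) : Prop where
  agreement : ∀ (E : Execution n D (Option V)) (v : V), E.IsRun P f Δ σ →
    E.input = broadcastInput L v → Agreement P E
  validity : ∀ (E : Execution n D (Option V)) (v : V), E.IsRun P f Δ σ →
    E.input = broadcastInput L v → L ∉ E.byz →
    ∀ i, i ∉ E.byz → (∃ t, E.Commits P i t (some v)) ∧ E.Terminates P i
  termination : ∀ (E : Execution n D (Option V)) (v : V), E.IsRun P f Δ σ →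
    E.input = broadcastInput L v →
    ∀ i, i ∉ E.byz → (∃ t o, E.Commits P i t o) ∧ E.Terminates P i

/-- `P` solves Byzantine reliable broadcast: as for Byzantine broadcast, except that
termination is only required when some honest party commits and terminates. -/
structure SolvesBRB {n : ℕ} {D V : Type*} (P : Protocol n D (Option V) (Option V)) (L : Fin n)
    (f : ℕ) (Δ σ : ℝ) : Prop where
  agreement : ∀ (E : Execution n D (Option V)) (v : V), E.IsRun P f Δ σ →
    E.input = broadcastInput L v → Agreement P E
  validity : ∀ (E : Execution n D (Option V)) (v : V), E.IsRun P f Δ σ →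
    E.input = broadcastInput L v → L ∉ E.byz →
    ∀ i, i ∉ E.byz → (∃ t, E.Commits P i t (some v)) ∧ E.Terminates P i
  termination : ∀ (E : Execution n D (Option V)) (v : V), E.IsRun P f Δ σ →
    E.input = broadcastInput L v →
    (∃ j, j ∉ E.byz ∧ (∃ t o, E.Commits P j t o) ∧ E.Terminates P j) →
    ∀ i, i ∉ E.byz → (∃ t o, E.Commits P i t o) ∧ E.Terminates P i

/-- `P` solves Byzantine agreement on values in `W`. -/
structure SolvesBA {n : ℕ} {D W : Type*} (P : Protocol n D W W) (f : ℕ) (Δ σ : ℝ) : Prop where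
  agreement : ∀ E : Execution n D W, E.IsRun P f Δ σ → Agreement P E
  validity : ∀ (E : Execution n D W) (w : W), E.IsRun P f Δ σ → (∀ i, i ∉ E.byz → E.input i = w) →
    ∀ i, i ∉ E.byz → ∃ t, E.Commits P i t w
  termination : ∀ E : Execution n D W, E.IsRun P f Δ σ →
    ∀ i, i ∉ E.byz → (∃ t o, E.Commits P i t o) ∧ E.Terminates P i

/-- If the broadcaster is honest, then all honest parties commit within time `T` since the
broadcaster starts, in all executions with delays at most `δ` and clock skew at most `σ`. -/
def HasGoodCaseLatency {n : ℕ} {D V : Type*} (P : Protocol n D (Option V) (Option V))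
    (L : Fin n) (f : ℕ) (δ σ T : ℝ) : Prop :=
  ∀ (E : Execution n D (Option V)) (v : V), E.IsRun P f δ σ →
    E.input = broadcastInput L v → L ∉ E.byz →
    ∀ i, i ∉ E.byz → ∃ t o, t ≤ E.start L + T ∧ E.Commits P i t o

/-! ## The broadcast protocol -/

/-- Atoms of the messages of the broadcast protocol. -/
inductive Atom (V : Type*) where
  | propose : V → Atom V
  | vote : Atom V
  | commit : V → Atom V

namespace ThirdBB

variable {n : ℕ} {V D : Type*}

/-- The body of a proposal of `v`. The atoms of the messages of the agreement primitive,
in `D`, are kept apart from those of the broadcast protocol. -/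
def proposeBody (v : V) : Term n (Atom V ⊕ D) := .data (.inl (.propose v))

/-- The proposal of `v`, signed by the broadcaster. -/
def proposeMsg (L : Fin n) (v : V) : Term n (Atom V ⊕ D) := .sign L (proposeBody v)

/-- The vote of `k` for `v`: it contains the signed proposal and is signed by `k`. -/
def voteMsg (L k : Fin n) (v : V) : Term n (Atom V ⊕ D) :=
  .sign k (.pair (.data (.inl .vote)) (proposeMsg L v))

/-- The statement of `k`, signed by `k`, that it has committed `v`. -/
def commitMsg (k : Fin n) (v : V) : Term n (Atom V ⊕ D) := .sign k (.data (.inl (.commit v)))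

/-- With the parameter `σ = Δ` this is `2Δ + σ`. -/
def commitDeadline (Δ : ℝ) : ℝ := 2 * Δ + Δ

/-- With the parameter `σ = Δ` this is `3Δ + 2σ`. -/
def lockTime (Δ : ℝ) : ℝ := 3 * Δ + 2 * Δ

/-- `v` is a first valid proposal that `i` receives from the broadcaster, at local time `t`.
The broadcaster has its own proposal at local time `0`. -/
def IsFirstProposal (L i : Fin n) (x : Option V) (H : History n (Atom V ⊕ D)) (t : ℝ) (v : V) :
    Prop :=
  (i = L ∧ t = 0 ∧ x = some v) ∨
  (i ≠ L ∧ (t, L, proposeMsg L v) ∈ H ∧ ∀ t' w, (t', L, proposeMsg L w) ∈ H → t ≤ t')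

open Classical in
/-- The first valid proposal and the local time at which it is received; one of them is chosen
if several arrive at the same time. -/
def firstProposal (L i : Fin n) (x : Option V) (H : History n (Atom V ⊕ D)) : Option (ℝ × V) :=
  if h : ∃ p : ℝ × V, IsFirstProposal L i x H p.1 p.2 then some h.choose else none

/-- `i` knows a proposal of `v` signed by the broadcaster. -/
def Seen (L i : Fin n) (x : Option V) (H : History n (Atom V ⊕ D)) (v : V) : Prop :=
  (i = L ∧ x = some v) ∨ ∃ e ∈ H, (L, proposeBody v) ∈ e.2.2.sigs

/-- `i` detects equivocation. -/
def Equivocation (L i : Fin n) (x : Option V) (H : History n (Atom V ⊕ D)) : Prop :=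
  ∃ v w, v ≠ w ∧ Seen L i x H v ∧ Seen L i x H w

/-- `i` has the vote of `k` for `v`, its own vote included. -/
def HasVote (L i : Fin n) (x : Option V) (H : History n (Atom V ⊕ D)) (k : Fin n) (v : V) :
    Prop :=
  (∃ t j, (t, j, voteMsg L k v) ∈ H) ∨ (k = i ∧ ∃ t, firstProposal L i x H = some (t, v))

/-- `i` has `n - f` votes for `v`. -/
def Quorum (f : ℕ) (L i : Fin n) (x : Option V) (H : History n (Atom V ⊕ D)) (v : V) : Prop :=
  n - f ≤ {k | HasVote L i x H k v}.ncard

/-- At local time `t` party `i`, which voted for `v`, whose vote timer has expired, and which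
detected no equivocation until the timer expired, has `n - f` votes for `v`; here `t` is the
time when the timer expires or a time when a vote for `v` is received. -/
def VotesReady (f : ℕ) (L : Fin n) (Δ : ℝ) (i : Fin n) (x : Option V)
    (H : History n (Atom V ⊕ D)) (t : ℝ) (v : V) : Prop :=
  ∃ t₀, firstProposal L i x (H.upTo t) = some (t₀, v) ∧ t₀ + Δ ≤ t ∧
    ¬ Equivocation L i x (H.upTo (t₀ + Δ)) ∧ Quorum f L i x (H.upTo t) v ∧
    (t = t₀ + Δ ∨ ∃ j k, (t, j, voteMsg L k v) ∈ H)

/-- `i` commits `v` at local time `t` on `n - f` votes. -/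
def FastCommit (f : ℕ) (L : Fin n) (Δ : ℝ) (i : Fin n) (x : Option V)
    (H : History n (Atom V ⊕ D)) (t : ℝ) (v : V) : Prop :=
  t ≤ commitDeadline Δ ∧ VotesReady f L Δ i x H t v

/-- `H` shows `n - f` votes for two different values, and a commit message for `u` from a
party that is not in the intersection of the two sets of voters. -/
def Rescue (f : ℕ) (L i : Fin n) (x : Option V) (H : History n (Atom V ⊕ D)) (u : V) : Prop :=
  ∃ v w, v ≠ w ∧ Quorum f L i x H v ∧ Quorum f L i x H w ∧
    ∃ k, ¬ (HasVote L i x H k v ∧ HasVote L i x H k w) ∧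
      ∃ t j, (t, j, commitMsg k u) ∈ H

open Classical in
/-- Some value with a given property, if there is one. -/
def pick (p : V → Prop) : Option V := if h : ∃ v, p v then some h.choose else none

/-- The value that `i` has committed on `n - f` votes, if any. -/
def fastValue (f : ℕ) (L : Fin n) (Δ : ℝ) (i : Fin n) (x : Option V)
    (H : History n (Atom V ⊕ D)) : Option V :=
  pick fun v => ∃ t, FastCommit f L Δ i x H t v

/-- The value that `i` commits at the lock time because of a commit message, if any. -/
def rescueValue (f : ℕ) (L : Fin n) (Δ : ℝ) (i : Fin n) (x : Option V)
    (H : History n (Atom V ⊕ D)) : Option V :=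
  pick fun u => Rescue f L i x (H.upTo (lockTime Δ)) u

open Classical in
/-- The variable `lock` after local time `3Δ + 2σ`: the only value with `n - f` votes; or
else the value of a trusted commit message; or else what it was before, namely the value that
was committed on `n - f` votes, or `⊥`. -/
def lock (f : ℕ) (L : Fin n) (Δ : ℝ) (i : Fin n) (x : Option V)
    (H : History n (Atom V ⊕ D)) : Option V :=
  if ∃! v, Quorum f L i x (H.upTo (lockTime Δ)) v then
    pick fun v => Quorum f L i x (H.upTo (lockTime Δ)) v
  else if (rescueValue f L Δ i x H).isSome then rescueValue f L Δ i x H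
  else fastValue f L Δ i x H

/-- The messages of the agreement instance, which starts at local time `3Δ + 2σ`; earlier ones
are received when it starts. -/
def innerHistory (Δ : ℝ) (H : History n (Atom V ⊕ D)) : History n D :=
  {e | ∃ t, (t, e.2.1, e.2.2.map Sum.inr) ∈ H ∧ e.1 = max (t - lockTime Δ) 0}

/-- Everything that `i` sends to `j` at local time `t`. -/
def Sends (f : ℕ) (L : Fin n) (Δ : ℝ) (BA : Protocol n D (Option V) (Option V)) (i : Fin n)
    (x : Option V) (H : History n (Atom V ⊕ D)) (t : ℝ) (j : Fin n)
    (m : Term n (Atom V ⊕ D)) : Prop :=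
  -- propose
  (i = L ∧ t = 0 ∧ ∃ v, x = some v ∧ m = proposeMsg L v) ∨
  -- vote
  (∃ v, firstProposal L i x H = some (t, v) ∧ m = voteMsg L i v) ∨
  -- forward the votes
  (∃ v, VotesReady f L Δ i x H t v ∧ ∃ k, HasVote L i x H k v ∧ m = voteMsg L k v) ∨
  -- announce the commit
  (∃ v, FastCommit f L Δ i x H t v ∧ m = commitMsg i v) ∨
  -- take part in Byzantine agreement on `lock`
  (lockTime Δ ≤ t ∧ ∃ m' ∈ BA.send i (lock f L Δ i x H) (innerHistory Δ H) (t - lockTime Δ) j,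
    m = m'.map Sum.inr)

open Classical in
/-- What `i` commits at local time `t`. -/
def commitAt (f : ℕ) (L : Fin n) (Δ : ℝ) (BA : Protocol n D (Option V) (Option V)) (i : Fin n)
    (x : Option V) (H : History n (Atom V ⊕ D)) (t : ℝ) : Option (Option V) :=
  if t < lockTime Δ then
    -- commit `v` on `n - f` votes
    (pick fun v => FastCommit f L Δ i x H t v).map some
  else if (fastValue f L Δ i x H).isSome then none
  else if (rescueValue f L Δ i x H).isSome then
    -- commit on a trusted commit message
    if t = lockTime Δ then some (rescueValue f L Δ i x H) else none
  else
    -- commit the output of Byzantine agreement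
    BA.commit i (lock f L Δ i x H) (innerHistory Δ H) (t - lockTime Δ)

theorem proposal_mem_of_firstProposal {L i : Fin n} {x : Option V}
    {H : History n (Atom V ⊕ D)} {t : ℝ} {v : V} (h : firstProposal L i x H = some (t, v))
    (hi : L ≠ i) : (t, L, proposeMsg L v) ∈ H := by
  unfold firstProposal at h
  split_ifs at h with hp
  have h1 := hp.choose_spec
  rw [Option.some.inj h] at h1
  rcases h1 with h1 | h1
  · exact absurd h1.1.symm hi
  · exact h1.2.1

theorem sigs_voteMsg {L k : Fin n} {v : V} :
    (voteMsg L k v : Term n (Atom V ⊕ D)).sigs =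
      {(k, .pair (.data (.inl .vote)) (proposeMsg L v)), (L, proposeBody v)} := by
  ext p
  simp [voteMsg, proposeMsg, proposeBody, Term.sigs]

theorem firstProposal_sig {L i : Fin n} {x : Option V} {H : History n (Atom V ⊕ D)} {t : ℝ}
    {v : V} (h : firstProposal L i x H = some (t, v)) {k : Fin n} {u : Term n (Atom V ⊕ D)}
    (hu : (k, u) ∈ (voteMsg L i v : Term n (Atom V ⊕ D)).sigs) (hk : k ≠ i) :
    ∃ e ∈ H, (k, u) ∈ e.2.2.sigs := by
  rw [sigs_voteMsg] at hu
  rcases hu with hu | hu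
  · exact absurd (Prod.mk.inj hu).1 hk
  · obtain ⟨rfl, rfl⟩ := Prod.mk.inj hu
    exact ⟨_, proposal_mem_of_firstProposal h hk, by simp [proposeMsg, Term.sigs]⟩

theorem sends_authentic (f : ℕ) (L : Fin n) (Δ : ℝ) (BA : Protocol n D (Option V) (Option V))
    (i : Fin n) (x : Option V) (H : History n (Atom V ⊕ D)) (t : ℝ) (j : Fin n)
    (m : Term n (Atom V ⊕ D)) (hm : Sends f L Δ BA i x H t j m) (k : Fin n)
    (u : Term n (Atom V ⊕ D)) (hu : (k, u) ∈ m.sigs) (hk : k ≠ i) :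
    ∃ e ∈ H, (k, u) ∈ e.2.2.sigs := by
  rcases hm with ⟨rfl, -, v, -, rfl⟩ | ⟨v, hv, rfl⟩ | ⟨v, -, k', hk', rfl⟩ | ⟨v, -, rfl⟩ |
    ⟨-, m', hm', rfl⟩
  · simp [proposeMsg, proposeBody, Term.sigs, hk] at hu
  · exact firstProposal_sig hv hu hk
  · rcases hk' with ⟨t', j', h⟩ | ⟨rfl, t', h⟩
    · exact ⟨_, h, hu⟩
    · exact firstProposal_sig h hu hk
  · simp [commitMsg, Term.sigs, hk] at hu
  · obtain ⟨u', hu', rfl⟩ := (Term.mem_sigs_map _ _ _ _).1 hu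
    obtain ⟨e, ⟨t', he, -⟩, he'⟩ := BA.authentic _ _ _ _ _ _ hm' k u' hu' hk
    exact ⟨_, he, (Term.mem_sigs_map _ _ _ _).2 ⟨u', he', rfl⟩⟩

end ThirdBB

/-- The `(Δ+δ)`-`n/3` Byzantine broadcast protocol with broadcaster `L`, for `n` parties of
which `f` may be faulty, on top of the Byzantine agreement protocol `BA`. It terminates when the
agreement instance does. -/
def thirdBB {n : ℕ} {V D : Type*} (f : ℕ) (L : Fin n) (Δ : ℝ)
    (BA : Protocol n D (Option V) (Option V)) :
    Protocol n (Atom V ⊕ D) (Option V) (Option V) where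
  send i x H t j := {m | ThirdBB.Sends f L Δ BA i x H t j m}
  commit i x H t := ThirdBB.commitAt f L Δ BA i x H t
  halt i x H t := ThirdBB.lockTime Δ ≤ t ∧
    BA.halt i (ThirdBB.lock f L Δ i x H) (ThirdBB.innerHistory Δ H) (t - ThirdBB.lockTime Δ)
  authentic i x H t j m hm k u hu hk :=
    ThirdBB.sends_authentic f L Δ BA i x H t j m hm k u hu hk

end GoodCase

end

/-!
The upper bound is analysed on the whole history `Execution.hist` of each party; what a party knows
at a given time is a truncation of it, and every quantity that the protocol computes is
stable under truncation at a late enough time.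

*Fast commits agree* (`FastCommits.unique`). If two honest parties vote for different values, then
the vote of the earlier voter, which contains the proposal, reaches the later voter before
its timer of length `Δ` expires, so the latter detects equivocation and does not commit.

*Fast commits determine the locks* (`FastCommits.lock_eq`). A party that commits `v` on `n - f`
votes does so by local time `3 Δ` and forwards the votes, so all honest parties have them at
their lock times. A party that also has `n - f` votes for another value knows a set of
at least `n - 2 f ≥ f` parties that voted twice. These are Byzantine, hence they are all the
Byzantine parties, and a commit message of anybody else is to be trusted
(`Rescue.exists_fastCommits`).
So all honest parties enter the agreement instance with `v`, and by its validity they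
commit `v`. If no honest party commits on votes, then all of them commit the output of the
agreement instance. That the agreement instance is a run of the given agreement protocol is
`isRun_innerRun`: its messages are recognised by their atoms, so honest signatures from the
broadcast protocol are of no use in it.

*The good case* (`exists_fastCommit`). The proposal of an honest broadcaster arrives within time
`δ`, so the timers expire within `δ + Δ` and the honest votes arrive within `2 δ ≤ Δ + δ`.

Statements about the origin of signatures rest on `Execution.IsRun.exists_fresh`, an
induction along the causal order.

*The lower bound* (`le_goodCaseLatency`). The parties are split into groups `A`, `B`, `C` of `f`
parties, with the broadcaster in `C`. Messages between `A` and `B` take time `Δ`, all others `δ`.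
When `C` is Byzantine it can show `A` an honest broadcaster with input `v`, and `B` one with
input `w ≠ v`. Before time `Δ + δ` nothing that `B` sends at time `δ` or later has reached `A`, and
before time `δ` the parties in `B` have received nothing. So `A` cannot tell this
execution from one in which the broadcaster is honest and `B` is Byzantine and falls silent at time
`δ` (`Replay.view_eq`), and the same holds with `A` and `B` exchanged. If the good-case latency were
less than `Δ + δ`, then `A` would commit `v` and `B` would commit `w`. These executions are obtained
from a description of the Byzantine behaviour by `Execution.unroll`; since all
delays are at least `δ > 0`, the behaviour of the honest parties is determined step by step.
-/

namespace GoodCase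

/-! ### Messages and histories -/

namespace Term

theorem map_injective {n : ℕ} {D D' : Type*} {g : D → D'} (hg : Function.Injective g) :
    Function.Injective (map (n := n) g) := by
  intro a
  induction a with
  | data d => intro b h; cases b <;> simp_all [map, hg.eq_iff]
  | pair a₁ a₂ ih₁ ih₂ =>
    intro b h
    cases b with
    | pair b₁ b₂ =>
      simp only [map, pair.injEq] at h
      rw [ih₁ h.1, ih₂ h.2]
    | data _ => simp [map] at h
    | sign _ _ => simp [map] at h
  | sign i a ih =>
    intro b h
    cases b with
    | sign j b =>
      simp only [map, sign.injEq] at h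
      rw [h.1, ih h.2]
    | data _ => simp [map] at h
    | pair _ _ => simp [map] at h

end Term

theorem History.upTo_upTo {n : ℕ} {D : Type*} (H : History n D) {s t : ℝ} (h : s ≤ t) :
    (H.upTo t).upTo s = H.upTo s := by
  ext e
  simp only [History.upTo, Set.mem_ofPred_eq]
  exact ⟨fun he => ⟨he.1.1, he.2⟩, fun he => ⟨⟨he.1, he.2.trans h⟩, he.2⟩⟩

namespace Execution

variable {n : ℕ} {D I O : Type*} {E : Execution n D I} {P : Protocol n D I O} {f : ℕ} {δ σ : ℝ}

/-- Everything that party `i` ever receives, with the local times of receipt. -/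
def hist (E : Execution n D I) (i : Fin n) : History n D :=
  {e | e.2.1 ≠ i ∧ ∃ s, e.2.2 ∈ E.sent e.2.1 i s ∧
    e.1 = max (s + E.delay e.2.1 i s e.2.2) (E.start i) - E.start i}

theorem view_eq (E : Execution n D I) (i : Fin n) (t : ℝ) :
    E.view i t = (E.hist i).upTo (t - E.start i) := by
  ext e
  simp only [view, hist, History.upTo, Set.mem_ofPred_eq]
  constructor
  · rintro ⟨h, s, h1, h2, h3⟩
    exact ⟨⟨h, s, h1, h2⟩, h3⟩
  · rintro ⟨⟨h, s, h1, h2⟩, h3⟩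
    exact ⟨h, s, h1, h2, h3⟩

theorem nonneg_of_mem_hist {i : Fin n} {e : ℝ × Fin n × Term n D} (h : e ∈ E.hist i) :
    0 ≤ e.1 := by
  obtain ⟨-, s, -, h⟩ := h
  rw [h]
  linarith [le_max_right (s + E.delay e.2.1 i s e.2.2) (E.start i)]

/-- A message in the view at time `t` was sent, and has arrived, by time `t`. -/
theorem exists_sent_of_mem_view {i : Fin n} {t : ℝ} {e : ℝ × Fin n × Term n D}
    (h : e ∈ E.view i t) :
    e.2.1 ≠ i ∧ ∃ s, e.2.2 ∈ E.sent e.2.1 i s ∧ s + E.delay e.2.1 i s e.2.2 ≤ t := by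
  obtain ⟨h, s, h1, h2, h3⟩ := h
  exact ⟨h, s, h1, by linarith [le_max_left (s + E.delay e.2.1 i s e.2.2) (E.start i)]⟩

theorem IsRun.mono (h : E.IsRun P f δ σ) {δ' σ' : ℝ} (hδ : δ ≤ δ') (hσ : σ ≤ σ') :
    E.IsRun P f δ' σ' where
  faults := h.faults
  skew i j hi hj := (h.skew i j hi hj).trans hσ
  delay_nonneg := h.delay_nonneg
  delay_le i j s m hi hj := (h.delay_le i j s m hi hj).trans hδ
  honest := h.honest
  unforgeable := h.unforgeable
  causal := h.causal

theorem IsRun.mem_send (h : E.IsRun P f δ σ) {i j : Fin n} {s : ℝ} {m : Term n D}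
    (hi : i ∉ E.byz) (hij : i ≠ j) (hm : m ∈ E.sent i j s) :
    E.start i ≤ s ∧ E.Active P i s ∧
      m ∈ P.send i (E.input i) (E.view i s) (s - E.start i) j := by
  rw [h.honest i j s hi hij] at hm
  exact hm

/-- Every signature of an honest party `k` in a message that some honest party sends or receives
goes back, along the causal order, to a message in which `k` produces it without having
received it before. -/
theorem IsRun.exists_fresh (h : E.IsRun P f δ σ) {k : Fin n} {u : Term n D} (hk : k ∉ E.byz)
    {i j : Fin n} {s : ℝ} {m : Term n D} (hij : i ≠ j) (hb : ¬ (i ∈ E.byz ∧ j ∈ E.byz))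
    (hm : m ∈ E.sent i j s) (hu : (k, u) ∈ m.sigs) :
    ∃ s' j' m', k ≠ j' ∧ m' ∈ E.sent k j' s' ∧ (k, u) ∈ m'.sigs ∧
      ∀ e ∈ E.view k s', (k, u) ∉ e.2.2.sigs := by
  suffices H : ∀ y : Option (Fin n) × ℝ, ∀ i j m, i ≠ j → ¬ (i ∈ E.byz ∧ j ∈ E.byz) →
      E.site i = y.1 → m ∈ E.sent i j y.2 → (k, u) ∈ m.sigs →
      ∃ s' j' m', k ≠ j' ∧ m' ∈ E.sent k j' s' ∧ (k, u) ∈ m'.sigs ∧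
        ∀ e ∈ E.view k s', (k, u) ∉ e.2.2.sigs from
    H (E.site i, s) i j m hij hb rfl hm hu
  intro y
  induction y using h.causal.induction with
  | _ y ih =>
    intro i j m hij hb hy hm hu
    by_cases hi : i ∈ E.byz
    · obtain ⟨i', b', s', m', hi', hb', hm', hs', hu'⟩ :=
        h.unforgeable i j y.2 m hi (fun hj => hb ⟨hi, hj⟩) hm k u hk hu
      have hne : i' ≠ b' := fun e => hi' (e ▸ hb')
      have hsite : E.site b' = y.1 := by rw [← hy]; simp [site, hi, hb']
      exact ih (E.site i', s') ⟨i', b', m', hne, fun hh => hi' hh.1, rfl, hsite, hm', hs'⟩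
        i' b' m' hne (fun hh => hi' hh.1) rfl hm' hu'
    · obtain ⟨-, -, hsend⟩ := h.mem_send hi hij hm
      by_cases he : ∃ e ∈ E.view i y.2, (k, u) ∈ e.2.2.sigs
      · obtain ⟨e, he, hue⟩ := he
        obtain ⟨hne, s', hm', hs'⟩ := exists_sent_of_mem_view he
        exact ih (E.site e.2.1, s') ⟨e.2.1, i, e.2.2, hne, fun hh => hi hh.2, rfl, hy, hm', hs'⟩
          e.2.1 i e.2.2 hne (fun hh => hi hh.2) rfl hm' hue
      · have hik : k = i := by
          by_contra hne
          exact he (P.authentic i _ _ _ j m hsend k u hu hne)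
        subst hik
        exact ⟨y.2, j, m, hij, hm, hu, fun e hev hue => he ⟨e, hev, hue⟩⟩

/-- A signature of a party outside a set `C` of honest parties that occurs in a message sent by
a party in `C` has entered `C` in a message from outside. -/
theorem IsRun.exists_entry (h : E.IsRun P f δ σ) {C : Finset (Fin n)}
    (hC : ∀ c ∈ C, c ∉ E.byz) {k : Fin n} {u : Term n D} (hk : k ∉ C)
    {c j : Fin n} {s : ℝ} {m : Term n D} (hc : c ∈ C) (hcj : c ≠ j)
    (hm : m ∈ E.sent c j s) (hu : (k, u) ∈ m.sigs) :
    ∃ i c' s' m', i ∉ C ∧ c' ∈ C ∧ m' ∈ E.sent i c' s' ∧ s' + E.delay i c' s' m' ≤ s ∧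
      (k, u) ∈ m'.sigs := by
  suffices H : ∀ y : Option (Fin n) × ℝ, ∀ c j m, c ∈ C → c ≠ j → E.site c = y.1 →
      m ∈ E.sent c j y.2 → (k, u) ∈ m.sigs →
      ∃ i c' s' m', i ∉ C ∧ c' ∈ C ∧ m' ∈ E.sent i c' s' ∧ s' + E.delay i c' s' m' ≤ y.2 ∧
        (k, u) ∈ m'.sigs from
    H (E.site c, s) c j m hc hcj rfl hm hu
  intro y
  induction y using h.causal.induction with
  | _ y ih =>
    intro c j m hc hcj hy hm hu
    obtain ⟨-, -, hsend⟩ := h.mem_send (hC c hc) hcj hm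
    obtain ⟨e, he, hue⟩ := P.authentic c _ _ _ j m hsend k u hu (fun hh => hk (hh ▸ hc))
    obtain ⟨hne, s', hm', hs'⟩ := exists_sent_of_mem_view he
    by_cases hec : e.2.1 ∈ C
    · obtain ⟨i, c', s'', m', h1, h2, h3, h4, h5⟩ := ih (E.site e.2.1, s')
        ⟨e.2.1, c, e.2.2, hne, fun hh => hC c hc hh.2, rfl, hy, hm', hs'⟩
        e.2.1 c e.2.2 hec hne rfl hm' hue
      exact ⟨i, c', s'', m', h1, h2, h3,
        by linarith [h.delay_nonneg e.2.1 c s' e.2.2, show s'' + _ ≤ s' from h4], h5⟩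
    · exact ⟨e.2.1, c, s', e.2.2, hec, hc, hm', hs', hue⟩

end Execution

namespace ThirdBB

/-! ### The local computation of the broadcast protocol -/

section Loc

variable {n : ℕ} {V D : Type*} {f : ℕ} {L i : Fin n} {Δ : ℝ} {x : Option V}
  {H : History n (Atom V ⊕ D)}

theorem of_pick_eq_some {p : V → Prop} {v : V} (h : pick p = some v) : p v := by
  unfold pick at h
  split_ifs at h with hp
  rw [← Option.some.inj h]
  exact hp.choose_spec

theorem pick_isSome {p : V → Prop} : (pick p).isSome ↔ ∃ v, p v := by
  unfold pick
  split_ifs with hp <;> simp [hp]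

/-- If only `v` can have the property, then `pick` finds `v` as soon as there is a value. -/
theorem pick_eq_some {p : V → Prop} {v : V} (hp : ∃ w, p w) (hv : ∀ w, p w → w = v) :
    pick p = some v := by
  obtain ⟨w, hw⟩ := Option.isSome_iff_exists.1 (pick_isSome.2 hp)
  rw [hw, hv w (of_pick_eq_some hw)]

theorem isFirstProposal_of_firstProposal {t : ℝ} {v : V}
    (h : firstProposal L i x H = some (t, v)) : IsFirstProposal L i x H t v := by
  unfold firstProposal at h
  split_ifs at h with hp
  have h1 := hp.choose_spec
  rwa [Option.some.inj h] at h1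

theorem firstProposal_congr {H' : History n (Atom V ⊕ D)}
    (h : ∀ t v, IsFirstProposal L i x H t v ↔ IsFirstProposal L i x H' t v) :
    firstProposal L i x H = firstProposal L i x H' := by
  have : (fun p : ℝ × V => IsFirstProposal L i x H p.1 p.2) =
      fun p => IsFirstProposal L i x H' p.1 p.2 := funext fun p => propext (h p.1 p.2)
  classical
  have key : ∀ p q : ℝ × V → Prop, p = q →
      (if h : ∃ y, p y then some h.choose else none) =
        (if h : ∃ y, q y then some h.choose else none) := by
    rintro p _ rfl
    rfl
  exact key _ _ this

/-- Once a first proposal has been received, later messages do not change it. -/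
theorem firstProposal_upTo_eq {s t : ℝ} {v : V} (hs : (s, L, proposeMsg L v) ∈ H ∨ i = L)
    (hst : s ≤ t) :
    firstProposal L i x (H.upTo t) = firstProposal L i x H := by
  apply firstProposal_congr
  intro t' w
  by_cases hi : i = L
  · simp [IsFirstProposal, hi]
  · have hs := hs.resolve_right hi
    simp only [IsFirstProposal, hi, false_and, false_or, not_false_eq_true, true_and, ne_eq,
      History.upTo, Set.mem_ofPred_eq]
    constructor
    · rintro ⟨⟨h1, h2⟩, h3⟩
      refine ⟨h1, fun t'' w' h => ?_⟩
      rcases le_total t'' t with h' | h'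
      · exact h3 t'' w' ⟨h, h'⟩
      · exact h2.trans h'
    · rintro ⟨h1, h2⟩
      exact ⟨⟨h1, (h2 s v hs).trans hst⟩, fun t'' w' h => h2 t'' w' h.1⟩

theorem firstProposal_of_upTo {t t₀ : ℝ} {v : V}
    (h : firstProposal L i x (H.upTo t) = some (t₀, v)) :
    firstProposal L i x H = some (t₀, v) := by
  rw [← h]
  by_cases hi : i = L
  · exact (firstProposal_upTo_eq (s := t) (v := v) (Or.inr hi) le_rfl).symm
  · have h1 := proposal_mem_of_firstProposal h (Ne.symm hi)
    exact (firstProposal_upTo_eq (Or.inl h1.1) h1.2).symm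

theorem firstProposal_upTo {t t₀ : ℝ} {v : V} (h : firstProposal L i x H = some (t₀, v))
    (ht : t₀ ≤ t) : firstProposal L i x (H.upTo t) = some (t₀, v) := by
  rw [← h]
  by_cases hi : i = L
  · exact firstProposal_upTo_eq (s := t) (v := v) (Or.inr hi) le_rfl
  · exact firstProposal_upTo_eq (Or.inl (proposal_mem_of_firstProposal h (Ne.symm hi))) ht

theorem seen_of_firstProposal {t₀ : ℝ} {v : V} (h : firstProposal L i x H = some (t₀, v)) :
    Seen L i x H v := by
  rcases isFirstProposal_of_firstProposal h with h1 | h1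
  · exact Or.inl ⟨h1.1, h1.2.2⟩
  · exact Or.inr ⟨_, h1.2.1, by simp [proposeMsg, Term.sigs]⟩

theorem HasVote.of_upTo {k : Fin n} {v : V} {t : ℝ} (h : HasVote L i x (H.upTo t) k v) :
    HasVote L i x H k v := by
  rcases h with ⟨t', j, h⟩ | ⟨rfl, t', h⟩
  · exact Or.inl ⟨t', j, h.1⟩
  · exact Or.inr ⟨rfl, t', firstProposal_of_upTo h⟩

theorem HasVote.upTo_mono {k : Fin n} {v : V} {s t : ℝ} (h : HasVote L i x (H.upTo s) k v)
    (hst : s ≤ t) : HasVote L i x (H.upTo t) k v := by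
  rw [← H.upTo_upTo hst] at h
  exact h.of_upTo

theorem Quorum.of_forall {H' : History n (Atom V ⊕ D)} {j : Fin n} {y : Option V} {v w : V}
    (h : Quorum f L i x H v) (hk : ∀ k, HasVote L i x H k v → HasVote L j y H' k w) :
    Quorum f L j y H' w :=
  le_trans h (Set.ncard_le_ncard (fun k hk' => hk k hk') (Set.toFinite _))

theorem votesReady_upTo {s t : ℝ} {v : V} (hst : t ≤ s) :
    VotesReady f L Δ i x (H.upTo s) t v ↔ VotesReady f L Δ i x H t v := by
  unfold VotesReady
  simp only [H.upTo_upTo hst]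
  refine exists_congr fun t₀ => and_congr_right fun _ => and_congr_right fun h => ?_
  rw [H.upTo_upTo (h.trans hst)]
  refine and_congr_right fun _ => and_congr_right fun _ => or_congr_right ?_
  simp [History.upTo, hst]

theorem fastCommit_upTo {s t : ℝ} {v : V} (hst : t ≤ s) :
    FastCommit f L Δ i x (H.upTo s) t v ↔ FastCommit f L Δ i x H t v :=
  and_congr_right fun _ => votesReady_upTo hst

theorem fastValue_upTo {s : ℝ} (hs : commitDeadline Δ ≤ s) :
    fastValue f L Δ i x (H.upTo s) = fastValue f L Δ i x H := by
  unfold fastValue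
  congr 1
  funext v
  refine propext (exists_congr fun t => ?_)
  by_cases ht : t ≤ commitDeadline Δ
  · exact fastCommit_upTo (ht.trans hs)
  · simp [FastCommit, ht]

theorem rescueValue_upTo {s : ℝ} (hs : lockTime Δ ≤ s) :
    rescueValue f L Δ i x (H.upTo s) = rescueValue f L Δ i x H := by
  unfold rescueValue
  rw [H.upTo_upTo hs]

/-! Nothing that is relevant for `lock` depends on messages received after the lock time. -/

theorem commitDeadline_lt_lockTime (hΔ : 0 < Δ) : commitDeadline Δ < lockTime Δ := by
  unfold commitDeadline lockTime
  linarith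

theorem lock_upTo (hΔ : 0 < Δ) {s : ℝ} (hs : lockTime Δ ≤ s) :
    lock f L Δ i x (H.upTo s) = lock f L Δ i x H := by
  unfold lock
  rw [H.upTo_upTo hs, rescueValue_upTo hs,
    fastValue_upTo ((commitDeadline_lt_lockTime hΔ).le.trans hs)]

/-! Messages of the agreement instance have no part in common with those of the broadcast
protocol proper, because their atoms are different. -/

theorem map_inr_ne_proposeBody (m : Term n D) (v : V) :
    m.map (Sum.inr : D → Atom V ⊕ D) ≠ proposeBody v := by
  cases m <;> simp [Term.map, proposeBody]

theorem map_inr_ne_voteBody (m : Term n D) (L : Fin n) (v : V) :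
    m.map (Sum.inr : D → Atom V ⊕ D) ≠ .pair (.data (.inl .vote)) (proposeMsg L v) := by
  cases m with
  | pair a b => cases a <;> simp [Term.map]
  | data _ => simp [Term.map]
  | sign _ _ => simp [Term.map]

theorem map_inr_ne_commitBody (m : Term n D) (v : V) :
    m.map (Sum.inr : D → Atom V ⊕ D) ≠ .data (.inl (.commit v)) := by
  cases m <;> simp [Term.map]

theorem not_mem_sigs_map_inr {m : Term n D} {k : Fin n} {u : Term n (Atom V ⊕ D)}
    (hu : ∀ u' : Term n D, u'.map Sum.inr ≠ u) :
    (k, u) ∉ (m.map (Sum.inr : D → Atom V ⊕ D)).sigs := by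
  rw [Term.mem_sigs_map]
  rintro ⟨u', -, rfl⟩
  exact hu u' rfl

theorem sigs_proposeMsg {v : V} :
    (proposeMsg L v : Term n (Atom V ⊕ D)).sigs = {(L, proposeBody v)} := by
  simp [proposeMsg, proposeBody, Term.sigs]

theorem sigs_commitMsg {v : V} : (commitMsg i v : Term n (Atom V ⊕ D)).sigs =
    {(i, .data (.inl (.commit v)))} := by
  simp [commitMsg, Term.sigs]

/-- The signatures in a message sent by the protocol are either all of the agreement instance or
all of the broadcast protocol proper. -/
theorem Sends.eq_map_of_mem_sigs {BA : Protocol n D (Option V) (Option V)} {t : ℝ} {j k : Fin n}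
    {m : Term n (Atom V ⊕ D)} {u : Term n D} (hm : Sends f L Δ BA i x H t j m)
    (hu : (k, u.map Sum.inr) ∈ m.sigs) : ∃ m' : Term n D, m = m'.map Sum.inr := by
  rcases hm with ⟨-, -, v, -, rfl⟩ | ⟨v, -, rfl⟩ | ⟨v, -, k', -, rfl⟩ | ⟨v, -, rfl⟩ |
    ⟨-, m', -, rfl⟩
  · rw [sigs_proposeMsg] at hu
    exact absurd (Prod.mk.inj hu).2 (map_inr_ne_proposeBody u v)
  · rw [sigs_voteMsg] at hu
    rcases hu with hu | hu
    · exact absurd (Prod.mk.inj hu).2 (map_inr_ne_voteBody u L v)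
    · exact absurd (Prod.mk.inj hu).2 (map_inr_ne_proposeBody u v)
  · rw [sigs_voteMsg] at hu
    rcases hu with hu | hu
    · exact absurd (Prod.mk.inj hu).2 (map_inr_ne_voteBody u L v)
    · exact absurd (Prod.mk.inj hu).2 (map_inr_ne_proposeBody u v)
  · rw [sigs_commitMsg] at hu
    exact absurd (Prod.mk.inj hu).2 (map_inr_ne_commitBody u v)
  · exact ⟨m', rfl⟩

theorem sends_map_iff {BA : Protocol n D (Option V) (Option V)} {t : ℝ} {j : Fin n}
    {m : Term n D} : Sends f L Δ BA i x H t j (m.map Sum.inr) ↔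
      lockTime Δ ≤ t ∧
        m ∈ BA.send i (lock f L Δ i x H) (innerHistory Δ H) (t - lockTime Δ) j := by
  constructor
  · have key : ∀ (k : Fin n) (u : Term n (Atom V ⊕ D)), (∀ u' : Term n D, u'.map Sum.inr ≠ u) →
        m.map Sum.inr ≠ .sign k u := by
      intro k u hu h
      cases m with
      | sign k' u' =>
        simp only [Term.map, Term.sign.injEq] at h
        exact hu u' h.2
      | data _ => simp [Term.map] at h
      | pair _ _ => simp [Term.map] at h
    rintro (⟨-, -, v, -, h⟩ | ⟨v, -, h⟩ | ⟨v, -, k', -, h⟩ | ⟨v, -, h⟩ | ⟨ht, m', hm', h⟩)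
    · exact absurd h (key _ _ fun u' => map_inr_ne_proposeBody u' v)
    · exact absurd h (key _ _ fun u' => map_inr_ne_voteBody u' L v)
    · exact absurd h (key _ _ fun u' => map_inr_ne_voteBody u' L v)
    · exact absurd h (key _ _ fun u' => map_inr_ne_commitBody u' v)
    · rw [Term.map_injective Sum.inr_injective h]
      exact ⟨ht, hm'⟩
  · rintro ⟨ht, hm⟩
    exact Or.inr (Or.inr (Or.inr (Or.inr ⟨ht, m, hm, rfl⟩)))

/-- A party that produces a vote signed by itself, not having received it, has voted. -/
theorem Sends.firstProposal_of_voteSig {BA : Protocol n D (Option V) (Option V)} {t : ℝ}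
    {j : Fin n} {m : Term n (Atom V ⊕ D)} {v : V} (hm : Sends f L Δ BA i x H t j m)
    (hu : (i, .pair (.data (.inl .vote)) (proposeMsg L v)) ∈ m.sigs)
    (hfresh : ∀ e ∈ H, (i, .pair (.data (.inl .vote)) (proposeMsg L v)) ∉ e.2.2.sigs) :
    ∃ t₀, firstProposal L i x H = some (t₀, v) := by
  have key : ∀ {k : Fin n} {w : V},
      (i, .pair (.data (.inl .vote)) (proposeMsg L v)) ∈
        (voteMsg L k w : Term n (Atom V ⊕ D)).sigs → i = k ∧ v = w := by
    intro k w h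
    rw [sigs_voteMsg] at h
    rcases h with h | h
    · simpa [proposeMsg, proposeBody] using h
    · simp [proposeBody] at h
  rcases hm with ⟨-, -, w, -, rfl⟩ | ⟨w, hw, rfl⟩ | ⟨w, -, k', hk', rfl⟩ | ⟨w, -, rfl⟩ |
    ⟨-, m', -, rfl⟩
  · simp [sigs_proposeMsg, proposeBody] at hu
  · obtain ⟨-, rfl⟩ := key hu
    exact ⟨t, hw⟩
  · obtain ⟨rfl, rfl⟩ := key hu
    rcases hk' with ⟨t', j', h⟩ | ⟨-, t', h⟩
    · exact absurd hu (hfresh _ h)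
    · exact ⟨t', h⟩
  · simp [sigs_commitMsg] at hu
  · exact absurd hu (not_mem_sigs_map_inr fun u' => map_inr_ne_voteBody u' L v)

/-- A party that sends a commit message signed by itself commits at that moment. -/
theorem Sends.fastCommit_of_commitSig {BA : Protocol n D (Option V) (Option V)} {t : ℝ}
    {j : Fin n} {m : Term n (Atom V ⊕ D)} {v : V} (hm : Sends f L Δ BA i x H t j m)
    (hu : (i, .data (.inl (.commit v))) ∈ m.sigs) : FastCommit f L Δ i x H t v := by
  rcases hm with ⟨-, -, w, -, rfl⟩ | ⟨w, hw, rfl⟩ | ⟨w, -, k', hk', rfl⟩ | ⟨w, hw, rfl⟩ |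
    ⟨-, m', -, rfl⟩
  · simp [sigs_proposeMsg, proposeBody] at hu
  · simp [sigs_voteMsg, proposeBody] at hu
  · simp [sigs_voteMsg, proposeBody] at hu
  · obtain rfl : v = w := by simpa [sigs_commitMsg] using hu
    exact hw
  · exact absurd hu (not_mem_sigs_map_inr fun u' => map_inr_ne_commitBody u' v)

/-- The broadcaster, when it follows the protocol, produces proposals of its input only. -/
theorem Sends.input_of_proposeSig {BA : Protocol n D (Option V) (Option V)} {t : ℝ}
    {j : Fin n} {m : Term n (Atom V ⊕ D)} {v : V} (hm : Sends f L Δ BA L x H t j m)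
    (hu : (L, proposeBody v) ∈ m.sigs) (hfresh : ∀ e ∈ H, (L, proposeBody v) ∉ e.2.2.sigs) :
    x = some v := by
  have key : ∀ {k : Fin n} {w : V},
      (L, proposeBody v) ∈ (voteMsg L k w : Term n (Atom V ⊕ D)).sigs → v = w := by
    intro k w h
    simpa [sigs_voteMsg, proposeBody] using h
  have own : ∀ {t₀ : ℝ} {w : V}, firstProposal L L x H = some (t₀, w) → x = some w := by
    intro t₀ w h
    rcases isFirstProposal_of_firstProposal h with h1 | h1
    · exact h1.2.2
    · exact absurd rfl h1.1
  rcases hm with ⟨-, -, w, hw, rfl⟩ | ⟨w, hw, rfl⟩ | ⟨w, -, k', hk', rfl⟩ | ⟨w, hw, rfl⟩ |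
    ⟨-, m', -, rfl⟩
  · obtain rfl : v = w := by simpa [sigs_proposeMsg, proposeBody] using hu
    exact hw
  · rw [key hu, own hw]
  · rcases hk' with ⟨t', j', h⟩ | ⟨-, t', h⟩
    · exact absurd hu (hfresh _ h)
    · rw [key hu, own h]
  · simp [sigs_commitMsg, proposeBody] at hu
  · exact absurd hu (not_mem_sigs_map_inr fun u' => map_inr_ne_proposeBody u' v)

/-- A bare proposal is sent only at local time `0`. -/
theorem Sends.eq_zero_of_proposeMsg {BA : Protocol n D (Option V) (Option V)} {t : ℝ}
    {j k : Fin n} {v : V} (hm : Sends f L Δ BA i x H t j (proposeMsg k v)) : t = 0 := by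
  rcases hm with ⟨-, ht, -⟩ | ⟨w, hw, h⟩ | ⟨w, -, k', hk', h⟩ | ⟨w, hw, h⟩ | ⟨-, m', -, h⟩
  · exact ht
  · simp [proposeMsg, proposeBody, voteMsg] at h
  · simp [proposeMsg, proposeBody, voteMsg] at h
  · simp [proposeMsg, proposeBody, commitMsg] at h
  · refine absurd ?_ (not_mem_sigs_map_inr (m := m') (k := k)
      fun u' => map_inr_ne_proposeBody u' v)
    rw [← h]
    simp [sigs_proposeMsg]

end Loc

end ThirdBB

end GoodCase

namespace GoodCase

namespace ThirdBB

/-! ### The agreement instance -/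

section Inner

variable {n : ℕ} {V D : Type*} {f : ℕ} {L : Fin n} {Δ δ σ : ℝ}
  {BA : Protocol n D (Option V) (Option V)} {E : Execution n (Atom V ⊕ D) (Option V)}

/-- The execution of the agreement instance inside an execution of the broadcast protocol: its
messages are those whose atoms all belong to the agreement protocol, every party starts
it at the lock time, and its inputs are the final values of `lock`. -/
noncomputable def innerRun (f : ℕ) (L : Fin n) (Δ : ℝ) (E : Execution n (Atom V ⊕ D) (Option V)) :
    Execution n D (Option V) where
  byz := E.byz
  input i := lock f L Δ i (E.input i) (E.hist i)
  start i := E.start i + lockTime Δ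
  sent i j s := {m | m.map Sum.inr ∈ E.sent i j s}
  delay i j s m := E.delay i j s (m.map Sum.inr)

theorem lockTime_nonneg (hΔ : 0 < Δ) : 0 ≤ lockTime Δ := by
  unfold lockTime
  linarith

theorem innerHistory_view (hΔ : 0 < Δ) {i : Fin n} {t : ℝ} (ht : E.start i + lockTime Δ ≤ t) :
    innerHistory Δ (E.view i t) = (innerRun f L Δ E).view i t := by
  have key : ∀ a b : ℝ, max (max a b - b - lockTime Δ) 0 =
      max a (b + lockTime Δ) - (b + lockTime Δ) := by
    intro a b
    have h0 := lockTime_nonneg hΔ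
    rcases le_total a b with h | h <;> rcases le_total a (b + lockTime Δ) with h' | h' <;>
      simp only [max_eq_left h, max_eq_right h, max_eq_left h', max_eq_right h'] <;>
      first
      | rw [max_eq_left (by linarith)]; linarith
      | rw [max_eq_right (by linarith)]; linarith
  ext e
  constructor
  · rintro ⟨t', ⟨hne, s, hm, h1, h2⟩, h3⟩
    dsimp only at hne hm h1 h2 h3
    refine ⟨hne, s, hm, ?_, ?_⟩
    · rw [h3, h1]
      exact key _ _
    · rw [h3]
      simp only [innerRun]
      exact max_le (by linarith) (by linarith)
  · rintro ⟨hne, s, hm, h1, h2⟩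
    simp only [innerRun] at h1 h2
    refine ⟨max (s + E.delay e.2.1 i s (e.2.2.map Sum.inr)) (E.start i) - E.start i,
      ⟨hne, s, hm, rfl, ?_⟩, ?_⟩
    · rw [h1, ← key] at h2
      have := (le_max_left _ _).trans h2
      dsimp only
      linarith
    · rw [h1]
      exact (key _ _).symm

theorem lock_view (hΔ : 0 < Δ) {i : Fin n} {t : ℝ} (ht : E.start i + lockTime Δ ≤ t) :
    lock f L Δ i (E.input i) (E.view i t) = (innerRun f L Δ E).input i := by
  rw [Execution.view_eq, lock_upTo hΔ (by linarith)]
  rfl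

theorem halt_iff (hΔ : 0 < Δ) {i : Fin n} {t : ℝ} :
    (thirdBB f L Δ BA).halt i (E.input i) (E.view i t) (t - E.start i) ↔
      (innerRun f L Δ E).start i ≤ t ∧ BA.halt i ((innerRun f L Δ E).input i)
        ((innerRun f L Δ E).view i t) (t - (innerRun f L Δ E).start i) := by
  have hs : (innerRun f L Δ E).start i = E.start i + lockTime Δ := rfl
  simp only [thirdBB, hs]
  constructor
  · rintro ⟨h1, h2⟩
    have h1 : E.start i + lockTime Δ ≤ t := by linarith
    rw [lock_view hΔ h1, innerHistory_view (f := f) (L := L) hΔ h1, sub_sub] at h2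
    exact ⟨h1, h2⟩
  · rintro ⟨h1, h2⟩
    rw [lock_view hΔ h1, innerHistory_view (f := f) (L := L) hΔ h1, sub_sub]
    exact ⟨by linarith, h2⟩

theorem active_iff (hΔ : 0 < Δ) {i : Fin n} {t : ℝ} :
    E.Active (thirdBB f L Δ BA) i t ↔ (innerRun f L Δ E).Active BA i t := by
  constructor
  · intro h t' h1 h2 h3
    refine h t' ?_ h2 ((halt_iff hΔ).2 ⟨h1, h3⟩)
    have := lockTime_nonneg hΔ
    have h1 : E.start i + lockTime Δ ≤ t' := h1
    linarith
  · intro h t' h1 h2 h3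
    obtain ⟨h4, h5⟩ := (halt_iff hΔ).1 h3
    exact h t' h4 h2 h5

theorem active_of_le {i : Fin n} {t : ℝ} (ht : t ≤ E.start i + lockTime Δ) :
    E.Active (thirdBB f L Δ BA) i t := by
  intro t' _ h2 h3
  have : lockTime Δ ≤ t' - E.start i := h3.1
  linarith

theorem sends_of_sent (h : E.IsRun (thirdBB f L Δ BA) f δ σ) {i j : Fin n} {s : ℝ}
    {m : Term n (Atom V ⊕ D)} (hi : i ∉ E.byz) (hij : i ≠ j) (hm : m ∈ E.sent i j s) :
    Sends f L Δ BA i (E.input i) (E.view i s) (s - E.start i) j m :=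
  (h.mem_send hi hij hm).2.2

theorem isRun_innerRun (hΔ : 0 < Δ) (h : E.IsRun (thirdBB f L Δ BA) f δ σ) :
    (innerRun f L Δ E).IsRun BA f δ σ where
  faults := h.faults
  skew i j hi hj := by
    have := h.skew i j hi hj
    simpa only [innerRun, add_sub_add_right_eq_sub] using this
  delay_nonneg i j s m := h.delay_nonneg i j s _
  delay_le i j s m hi hj := h.delay_le i j s _ hi hj
  honest i j s hi hij := by
    ext m
    change m.map Sum.inr ∈ E.sent i j s ↔ _
    rw [h.honest i j s hi hij]
    have hs : (innerRun f L Δ E).start i = E.start i + lockTime Δ := rfl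
    change (_ ∧ _ ∧ Sends f L Δ BA i _ _ _ _ _) ↔ (_ ∧ _ ∧ _)
    rw [sends_map_iff, active_iff hΔ, hs]
    have h0 := lockTime_nonneg hΔ
    constructor
    · rintro ⟨h1, h2, h3, h4⟩
      have h3 : E.start i + lockTime Δ ≤ s := by linarith
      rw [lock_view hΔ h3, innerHistory_view (f := f) (L := L) hΔ h3, sub_sub] at h4
      exact ⟨h3, h2, h4⟩
    · rintro ⟨h3, h2, h4⟩
      rw [lock_view hΔ h3, innerHistory_view (f := f) (L := L) hΔ h3, sub_sub]
      exact ⟨by linarith, h2, by linarith, h4⟩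
  unforgeable b j s m hb hj hm k u hk hu := by
    obtain ⟨i, b', s', m', hi, hb', hm', hs', hu'⟩ := h.unforgeable b j s _ hb hj hm k
      (u.map Sum.inr) hk ((Term.mem_sigs_map _ _ _ _).2 ⟨u, hu, rfl⟩)
    obtain ⟨m'', rfl⟩ := (sends_of_sent h hi (fun e => hi (e ▸ hb')) hm').eq_map_of_mem_sigs hu'
    obtain ⟨u', hu'', he⟩ := (Term.mem_sigs_map _ _ _ _).1 hu'
    rw [← Term.map_injective Sum.inr_injective he] at hu''
    exact ⟨i, b', s', m'', hi, hb', hm', hs', hu''⟩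
  causal := by
    refine Subrelation.wf (r := E.Influences) ?_ h.causal
    rintro y z ⟨i, j, m, h1, h2, h3, h4, h5, h6⟩
    exact ⟨i, j, m.map Sum.inr, h1, h2, h3, h4, h5, h6⟩

end Inner

/-! ### Votes, commits and locks of honest parties -/

section Upper

variable {n : ℕ} {V D : Type*} {f : ℕ} {L : Fin n} {Δ δ : ℝ}
  {BA : Protocol n D (Option V) (Option V)} {E : Execution n (Atom V ⊕ D) (Option V)}

/-- A message that an honest party sends at local time `τ`, before the lock time, is
received by every other honest party within the delay bound. -/
theorem exists_received (h : E.IsRun (thirdBB f L Δ BA) f δ δ) {i j : Fin n} {τ : ℝ}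
    {m : Term n (Atom V ⊕ D)} (hi : i ∉ E.byz) (hj : j ∉ E.byz) (hij : i ≠ j) (h0 : 0 ≤ τ)
    (hτ : τ ≤ lockTime Δ) (hm : Sends f L Δ BA i (E.input i) ((E.hist i).upTo τ) τ j m) :
    ∃ a, 0 ≤ a ∧ E.start j + a ≤ E.start i + τ + δ ∧ (a, i, m) ∈ E.hist j := by
  have hs : m ∈ E.sent i j (E.start i + τ) := by
    rw [h.honest i j _ hi hij]
    refine ⟨by linarith, active_of_le (by linarith), ?_⟩
    rw [Execution.view_eq, add_sub_cancel_left]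
    exact hm
  have hd := h.delay_le i j (E.start i + τ) m hi hj
  have hk := (abs_le.1 (h.skew j i hj hi)).2
  refine ⟨max (E.start i + τ + E.delay i j (E.start i + τ) m) (E.start j) - E.start j, ?_, ?_,
    hij, _, hs, rfl⟩
  · linarith [le_max_right (E.start i + τ + E.delay i j (E.start i + τ) m) (E.start j)]
  · have : max (E.start i + τ + E.delay i j (E.start i + τ) m) (E.start j) ≤
        E.start i + τ + δ := max_le (by linarith) (by linarith)
    linarith

theorem firstProposal_nonneg {i : Fin n} {t₀ : ℝ} {v : V}
    (h : firstProposal L i (E.input i) (E.hist i) = some (t₀, v)) : 0 ≤ t₀ := by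
  rcases isFirstProposal_of_firstProposal h with h1 | h1
  · exact h1.2.1.ge
  · exact Execution.nonneg_of_mem_hist h1.2.1

/-- Party `i` commits `v` on `n - f` votes at some time. -/
def FastCommits (f : ℕ) (L : Fin n) (Δ : ℝ) (E : Execution n (Atom V ⊕ D) (Option V))
    (i : Fin n) (v : V) : Prop :=
  ∃ t, FastCommit f L Δ i (E.input i) (E.hist i) t v

/-- Honest parties that commit on `n - f` votes commit the same value: the vote of the party
that votes first reaches the other one before the vote timer of the latter expires. -/
theorem FastCommits.unique (hΔ : 0 < Δ) (h : E.IsRun (thirdBB f L Δ BA) f Δ Δ) {i j : Fin n}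
    {v w : V} (hi : i ∉ E.byz) (hj : j ∉ E.byz) (hv : FastCommits f L Δ E i v)
    (hw : FastCommits f L Δ E j w) : v = w := by
  -- by symmetry, `i` may be assumed to vote first
  suffices key : ∀ i j v w, i ∉ E.byz → j ∉ E.byz →
      ∀ s t a b, FastCommit f L Δ i (E.input i) (E.hist i) a v →
        FastCommit f L Δ j (E.input j) (E.hist j) b w →
        firstProposal L i (E.input i) (E.hist i) = some (s, v) →
        firstProposal L j (E.input j) (E.hist j) = some (t, w) →
        E.start i + s ≤ E.start j + t → v = w by
    obtain ⟨a, ha⟩ := hv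
    obtain ⟨b, hb⟩ := hw
    obtain ⟨s, hs, -⟩ := ha.2
    obtain ⟨t, ht, -⟩ := hb.2
    rcases le_total (E.start i + s) (E.start j + t) with hst | hst
    · exact key i j v w hi hj s t a b ha hb (firstProposal_of_upTo hs)
        (firstProposal_of_upTo ht) hst
    · exact (key j i w v hj hi t s b a hb ha (firstProposal_of_upTo ht)
        (firstProposal_of_upTo hs) hst).symm
  intro i j v w hi hj s t a b ha hb hs ht hst
  by_cases hij : i = j
  · subst hij
    rw [hs] at ht
    exact (Prod.mk.inj (Option.some.inj ht)).2
  obtain ⟨s', hs', hsa, -⟩ := ha.2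
  obtain ⟨t', ht', -, heq, -⟩ := hb.2
  rw [firstProposal_of_upTo hs'] at hs
  obtain ⟨rfl, -⟩ := Prod.mk.inj (Option.some.inj hs)
  replace ht' := firstProposal_of_upTo ht'
  rw [ht'] at ht
  obtain ⟨rfl, -⟩ := Prod.mk.inj (Option.some.inj ht)
  have hs := firstProposal_of_upTo hs'
  have hle : s' ≤ lockTime Δ := by
    have := ha.1.trans (commitDeadline_lt_lockTime hΔ).le
    linarith
  obtain ⟨c, -, hc, hmem⟩ := exists_received h hi hj hij (firstProposal_nonneg hs) hle
    (m := voteMsg L i v) (Or.inr (Or.inl ⟨v, firstProposal_upTo hs le_rfl, rfl⟩))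
  by_contra hne
  refine heq ⟨v, w, hne, Or.inr ⟨_, ⟨hmem, ?_⟩, ?_⟩,
    seen_of_firstProposal (firstProposal_upTo ht' ?_)⟩
  · dsimp only
    linarith
  · simp [sigs_voteMsg]
  · linarith

theorem FastCommit.nonneg (hΔ : 0 < Δ) {i : Fin n} {t : ℝ} {v : V}
    (h : FastCommit f L Δ i (E.input i) (E.hist i) t v) : 0 ≤ t := by
  obtain ⟨-, t₀, h1, h2, -⟩ := h
  linarith [firstProposal_nonneg (firstProposal_of_upTo h1)]

/-- If an honest party commits `v` on `n - f` votes, then every honest party has these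
votes at its lock time. -/
theorem FastCommits.quorum (hΔ : 0 < Δ) (h : E.IsRun (thirdBB f L Δ BA) f Δ Δ) {i j : Fin n}
    {v : V} (hi : i ∉ E.byz) (hj : j ∉ E.byz) (hv : FastCommits f L Δ E i v) :
    Quorum f L j (E.input j) ((E.hist j).upTo (lockTime Δ)) v := by
  obtain ⟨t, ht⟩ := hv
  have hq : Quorum f L i (E.input i) ((E.hist i).upTo t) v := by
    obtain ⟨_, _, _, _, hq, _⟩ := ht.2
    exact hq
  have htl := ht.1.trans (commitDeadline_lt_lockTime hΔ).le
  refine hq.of_forall fun k hk => ?_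
  by_cases hij : i = j
  · subst hij
    exact hk.upTo_mono htl
  obtain ⟨a, -, ha, hmem⟩ := exists_received h hi hj hij (FastCommit.nonneg hΔ ht) htl
    (m := voteMsg L k v)
    (Or.inr (Or.inr (Or.inl ⟨v, (votesReady_upTo le_rfl).2 ht.2, k, hk, rfl⟩)))
  refine Or.inl ⟨a, i, hmem, ?_⟩
  have hsk := (abs_le.1 (h.skew i j hi hj)).2
  have := ht.1
  dsimp only
  unfold commitDeadline at this
  unfold lockTime
  linarith

theorem FastCommits.commitMsg_mem (hΔ : 0 < Δ) (h : E.IsRun (thirdBB f L Δ BA) f Δ Δ)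
    {i j : Fin n} {v : V} (hi : i ∉ E.byz) (hj : j ∉ E.byz) (hij : i ≠ j)
    (hv : FastCommits f L Δ E i v) :
    ∃ a, (a, i, commitMsg i v) ∈ (E.hist j).upTo (lockTime Δ) := by
  obtain ⟨t, ht⟩ := hv
  have htl := ht.1.trans (commitDeadline_lt_lockTime hΔ).le
  obtain ⟨a, -, ha, hmem⟩ := exists_received h hi hj hij (FastCommit.nonneg hΔ ht) htl
    (m := commitMsg i v)
    (Or.inr (Or.inr (Or.inr (Or.inl ⟨v, (fastCommit_upTo le_rfl).2 ht, rfl⟩))))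
  refine ⟨a, hmem, ?_⟩
  have hsk := (abs_le.1 (h.skew i j hi hj)).2
  have := ht.1
  dsimp only
  unfold commitDeadline at this
  unfold lockTime
  linarith

theorem exists_fresh_of_mem_hist (h : E.IsRun (thirdBB f L Δ BA) f δ δ) {i k : Fin n}
    {u : Term n (Atom V ⊕ D)} {e : ℝ × Fin n × Term n (Atom V ⊕ D)} (hi : i ∉ E.byz)
    (hk : k ∉ E.byz) (he : e ∈ E.hist i) (hu : (k, u) ∈ e.2.2.sigs) :
    ∃ s j m, Sends f L Δ BA k (E.input k) (E.view k s) (s - E.start k) j m ∧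
      (k, u) ∈ m.sigs ∧ ∀ e' ∈ E.view k s, (k, u) ∉ e'.2.2.sigs := by
  obtain ⟨hne, s, hm, -⟩ := he
  obtain ⟨s', j', m', h1, h2, h3, h4⟩ :=
    h.exists_fresh hk hne (fun hh => hi hh.2) hm hu
  exact ⟨s', j', m', sends_of_sent h hk h1 h2, h3, h4⟩

/-- An honest party is counted as a voter for `v` only if it has voted for `v`. -/
theorem HasVote.firstProposal_of_honest (h : E.IsRun (thirdBB f L Δ BA) f δ δ) {i k : Fin n}
    {v : V} (hi : i ∉ E.byz) (hk : k ∉ E.byz) (hv : HasVote L i (E.input i) (E.hist i) k v) :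
    ∃ t₀, firstProposal L k (E.input k) (E.hist k) = some (t₀, v) := by
  rcases hv with ⟨t, j, hm⟩ | ⟨rfl, t, ht⟩
  · obtain ⟨s, j', m, h1, h2, h3⟩ := exists_fresh_of_mem_hist h hi hk hm
      (u := .pair (.data (.inl .vote)) (proposeMsg L v)) (by simp [sigs_voteMsg])
    obtain ⟨t₀, ht₀⟩ := h1.firstProposal_of_voteSig h2 h3
    rw [Execution.view_eq] at ht₀
    exact ⟨t₀, firstProposal_of_upTo ht₀⟩
  · exact ⟨t, ht⟩

/-- A commit message is trusted only if an honest party has sent it: the voters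
for two different values are Byzantine and at least `n - 2 f ≥ f` in number, so they are
all the Byzantine parties. -/
theorem Rescue.exists_fastCommits (hf : 3 * f ≤ n) (h : E.IsRun (thirdBB f L Δ BA) f δ δ)
    {i : Fin n} {τ : ℝ} {u : V} (hi : i ∉ E.byz)
    (hu : Rescue f L i (E.input i) ((E.hist i).upTo τ) u) :
    ∃ k, k ∉ E.byz ∧ FastCommits f L Δ E k u := by
  classical
  obtain ⟨v, w, hvw, hv, hw, k, hk, t, j, hm⟩ := hu
  have hkb : k ∉ E.byz := by
    intro hkb
    unfold Quorum at hv hw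
    set A := {k | HasVote L i (E.input i) ((E.hist i).upTo τ) k v}
    set B := {k | HasVote L i (E.input i) ((E.hist i).upTo τ) k w}
    -- an honest party votes only once, so the common voters are Byzantine parties other than `k`
    have hsub : A ∩ B ⊆ ((E.byz.erase k : Finset (Fin n)) : Set (Fin n)) := by
      rintro k' ⟨h1, h2⟩
      rw [Finset.mem_coe, Finset.mem_erase]
      refine ⟨?_, ?_⟩
      · rintro rfl
        exact hk ⟨h1, h2⟩
      · by_contra hk'
        obtain ⟨t₁, ht₁⟩ := (HasVote.of_upTo h1).firstProposal_of_honest h hi hk'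
        obtain ⟨t₂, ht₂⟩ := (HasVote.of_upTo h2).firstProposal_of_honest h hi hk'
        rw [ht₁] at ht₂
        exact hvw (Prod.mk.inj (Option.some.inj ht₂)).2
    have h1 := Set.ncard_le_ncard hsub (Set.toFinite _)
    rw [Set.ncard_coe_finset, Finset.card_erase_of_mem hkb] at h1
    have h2 := Set.ncard_union_add_ncard_inter A B (Set.toFinite _) (Set.toFinite _)
    have h3 : (A ∪ B).ncard ≤ n := by
      have := Set.ncard_le_ncard (Set.subset_univ (A ∪ B)) (Set.toFinite _)
      simpa [Set.ncard_univ] using this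
    have h4 := h.faults
    have h5 : 0 < E.byz.card := Finset.card_pos.2 ⟨k, hkb⟩
    omega
  obtain ⟨s, j', m, h1, h2, -⟩ := exists_fresh_of_mem_hist h hi hkb hm.1
    (u := .data (.inl (.commit u))) (by simp [sigs_commitMsg])
  have := h1.fastCommit_of_commitSig h2
  rw [Execution.view_eq, fastCommit_upTo le_rfl] at this
  exact ⟨k, hkb, _, this⟩

/-- If an honest party commits `v` on `n - f` votes, then all honest parties enter the agreement
instance with `v`. -/
theorem FastCommits.lock_eq (hΔ : 0 < Δ) (hf : 3 * f ≤ n)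
    (h : E.IsRun (thirdBB f L Δ BA) f Δ Δ) {i j : Fin n} {v : V} (hi : i ∉ E.byz)
    (hj : j ∉ E.byz) (hv : FastCommits f L Δ E i v) :
    lock f L Δ j (E.input j) (E.hist j) = some v := by
  have hq := hv.quorum hΔ h hi hj
  have hr : ∀ u, Rescue f L j (E.input j) ((E.hist j).upTo (lockTime Δ)) u → u = v := by
    intro u hu
    obtain ⟨k, hk, hku⟩ := hu.exists_fastCommits hf h hj
    exact hku.unique hΔ h hk hi hv
  unfold lock
  split_ifs with h1 h2
  · exact pick_eq_some ⟨v, hq⟩ fun w hw => h1.unique hw hq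
  · exact pick_eq_some (pick_isSome.1 h2) hr
  · have hij : i = j := by
      -- otherwise `j` has a second quorum and the commit message of `i`, which it trusts because
      -- `i` has voted for `v` only
      by_contra hij
      obtain ⟨w, hw, hwv⟩ : ∃ w,
          Quorum f L j (E.input j) ((E.hist j).upTo (lockTime Δ)) w ∧ w ≠ v := by
        by_contra hall
        push Not at hall
        exact h1 ⟨v, hq, hall⟩
      obtain ⟨a, ha⟩ := hv.commitMsg_mem hΔ h hi hj hij
      refine h2 (pick_isSome.2 ⟨v, v, w, hwv.symm, hq, hw, i, ?_, a, i, ha⟩)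
      rintro ⟨h3, h4⟩
      obtain ⟨t₁, ht₁⟩ := (HasVote.of_upTo h3).firstProposal_of_honest h hj hi
      obtain ⟨t₂, ht₂⟩ := (HasVote.of_upTo h4).firstProposal_of_honest h hj hi
      rw [ht₁] at ht₂
      exact hwv (Prod.mk.inj (Option.some.inj ht₂)).2.symm
    subst hij
    exact pick_eq_some ⟨v, hv⟩ fun w hw => FastCommits.unique hΔ h hi hi hw hv

/-! ### Agreement and termination of the broadcast protocol -/

/-- A commit of an honest party is backed by a commit on `n - f` votes of some honest
party, or is a commit of the agreement instance. -/
theorem commits_cases (hΔ : 0 < Δ) (hf : 3 * f ≤ n) (h : E.IsRun (thirdBB f L Δ BA) f Δ Δ)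
    {i : Fin n} {t : ℝ} {o : Option V} (hi : i ∉ E.byz)
    (hc : E.Commits (thirdBB f L Δ BA) i t o) :
    (∃ k v, k ∉ E.byz ∧ FastCommits f L Δ E k v ∧ o = some v) ∨
      (innerRun f L Δ E).Commits BA i t o := by
  obtain ⟨h1, h2, h3⟩ := hc
  change commitAt f L Δ BA i _ _ _ = _ at h3
  unfold commitAt at h3
  split_ifs at h3 with h4 h5 h6 h7
  · obtain ⟨v, hv, rfl⟩ := Option.map_eq_some_iff.1 h3
    have := of_pick_eq_some hv
    rw [Execution.view_eq, fastCommit_upTo le_rfl] at this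
    exact Or.inl ⟨i, v, hi, ⟨_, this⟩, rfl⟩
  · have h8 : E.start i + lockTime Δ ≤ t := by linarith
    rw [Execution.view_eq, rescueValue_upTo (by linarith)] at h3 h6
    obtain ⟨v, hv⟩ := Option.isSome_iff_exists.1 h6
    obtain ⟨k, hk, hkv⟩ := (of_pick_eq_some hv).exists_fastCommits hf h hi
    rw [hv] at h3
    exact Or.inl ⟨k, v, hk, hkv, (Option.some.inj h3).symm⟩
  · have h8 : E.start i + lockTime Δ ≤ t := by linarith
    refine Or.inr ⟨h8, (active_iff hΔ).1 h2, ?_⟩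
    rw [lock_view hΔ h8, innerHistory_view (f := f) (L := L) hΔ h8, sub_sub] at h3
    exact h3

theorem agreement_thirdBB (hΔ : 0 < Δ) (hf : 3 * f ≤ n) (hBA : SolvesBA BA f Δ Δ)
    (h : E.IsRun (thirdBB f L Δ BA) f Δ Δ) : Agreement (thirdBB f L Δ BA) E := by
  have hin := isRun_innerRun hΔ h
  intro i j t t' o o' hi hj ho ho'
  by_cases hF : ∃ k v, k ∉ E.byz ∧ FastCommits f L Δ E k v
  · obtain ⟨k, v, hk, hv⟩ := hF
    have key : ∀ i t o, i ∉ E.byz → E.Commits (thirdBB f L Δ BA) i t o → o = some v := by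
      intro i t o hi ho
      rcases commits_cases hΔ hf h hi ho with ⟨k', v', hk', hv', rfl⟩ | hc
      · rw [hv'.unique hΔ h hk' hk hv]
      · obtain ⟨t₁, ht₁⟩ := hBA.validity _ (some v) hin
          (fun j hj => hv.lock_eq hΔ hf h hk hj) i hi
        exact hBA.agreement _ hin i i _ _ _ _ hi hi hc ht₁
    rw [key i t o hi ho, key j t' o' hj ho']
  · have key : ∀ i t o, i ∉ E.byz → E.Commits (thirdBB f L Δ BA) i t o →
        (innerRun f L Δ E).Commits BA i t o := by
      intro i t o hi ho
      rcases commits_cases hΔ hf h hi ho with ⟨k', v', hk', hv', -⟩ | hc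
      · exact absurd ⟨k', v', hk', hv'⟩ hF
      · exact hc
    exact hBA.agreement _ hin i j _ _ _ _ hi hj (key i t o hi ho) (key j t' o' hj ho')

theorem FastCommit.commits (hΔ : 0 < Δ) (h : E.IsRun (thirdBB f L Δ BA) f Δ Δ) {i : Fin n}
    {t : ℝ} {v : V} (hi : i ∉ E.byz)
    (hv : FastCommit f L Δ i (E.input i) (E.hist i) t v) :
    E.Commits (thirdBB f L Δ BA) i (E.start i + t) (some v) := by
  have h0 := FastCommit.nonneg hΔ hv
  have hlt := lt_of_le_of_lt hv.1 (commitDeadline_lt_lockTime hΔ)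
  refine ⟨by linarith, active_of_le (by linarith), ?_⟩
  change commitAt f L Δ BA i _ _ _ = _
  rw [Execution.view_eq, add_sub_cancel_left]
  unfold commitAt
  rw [if_pos hlt, Option.map_eq_some_iff]
  refine ⟨v, pick_eq_some ⟨v, (fastCommit_upTo le_rfl).2 hv⟩ fun w hw => ?_, rfl⟩
  exact FastCommits.unique hΔ h hi hi ⟨t, (fastCommit_upTo le_rfl).1 hw⟩ ⟨t, hv⟩

theorem terminates_thirdBB (hΔ : 0 < Δ) (hBA : SolvesBA BA f Δ Δ)
    (h : E.IsRun (thirdBB f L Δ BA) f Δ Δ) {i : Fin n} (hi : i ∉ E.byz) :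
    E.Terminates (thirdBB f L Δ BA) i := by
  obtain ⟨-, t, h1, h2⟩ := hBA.termination _ (isRun_innerRun hΔ h) i hi
  have h3 : E.start i + lockTime Δ ≤ t := h1
  exact ⟨t, by linarith [lockTime_nonneg hΔ], (halt_iff hΔ).2 ⟨h1, h2⟩⟩

theorem exists_commits_thirdBB (hΔ : 0 < Δ) (hBA : SolvesBA BA f Δ Δ)
    (h : E.IsRun (thirdBB f L Δ BA) f Δ Δ) {i : Fin n} (hi : i ∉ E.byz) :
    ∃ t o, E.Commits (thirdBB f L Δ BA) i t o := by
  have h0 := lockTime_nonneg hΔ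
  by_cases hF : (fastValue f L Δ i (E.input i) (E.hist i)).isSome
  · obtain ⟨v, t, ht⟩ := pick_isSome.1 hF
    exact ⟨_, _, ht.commits hΔ h hi⟩
  have hF' : ∀ t, E.start i + lockTime Δ ≤ t →
      ¬ (fastValue f L Δ i (E.input i) (E.view i t)).isSome := by
    intro t ht
    have := commitDeadline_lt_lockTime hΔ
    rwa [Execution.view_eq, fastValue_upTo (by linarith)]
  by_cases hR : (rescueValue f L Δ i (E.input i) (E.hist i)).isSome
  · refine ⟨E.start i + lockTime Δ, rescueValue f L Δ i (E.input i) (E.hist i), by linarith,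
      active_of_le le_rfl, ?_⟩
    change commitAt f L Δ BA i _ _ _ = _
    unfold commitAt
    have hr : rescueValue f L Δ i (E.input i) (E.view i (E.start i + lockTime Δ)) =
        rescueValue f L Δ i (E.input i) (E.hist i) := by
      rw [Execution.view_eq, rescueValue_upTo (by linarith)]
    rw [if_neg (by linarith), if_neg (hF' _ le_rfl), hr, if_pos hR, if_pos (by linarith)]
  · obtain ⟨⟨t, o, h1, h2, h3⟩, -⟩ := hBA.termination _ (isRun_innerRun hΔ h) i hi
    have h1 : E.start i + lockTime Δ ≤ t := h1
    refine ⟨t, o, by linarith, (active_iff hΔ).2 h2, ?_⟩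
    change commitAt f L Δ BA i _ _ _ = _
    unfold commitAt
    rw [if_neg (by linarith), if_neg (hF' _ h1), if_neg, lock_view hΔ h1,
      innerHistory_view (f := f) (L := L) hΔ h1, sub_sub]
    · exact h3
    · rwa [Execution.view_eq, rescueValue_upTo (by linarith)]

/-! ### The good case -/

theorem seen_of_honest_broadcaster (h : E.IsRun (thirdBB f L Δ BA) f δ δ) {v : V}
    (hL : L ∉ E.byz) (hv : E.input L = some v) {i : Fin n} (hi : i ∉ E.byz) {τ : ℝ} {w : V}
    (hw : Seen L i (E.input i) ((E.hist i).upTo τ) w) : w = v := by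
  rcases hw with ⟨rfl, hw⟩ | ⟨e, he, hu⟩
  · rw [hv] at hw
    exact (Option.some.inj hw).symm
  · obtain ⟨s, j, m, h1, h2, h3⟩ := exists_fresh_of_mem_hist h hi hL he.1 hu
    have := h1.input_of_proposeSig h2 h3
    rw [hv] at this
    exact (Option.some.inj this).symm

/-- An honest broadcaster's proposal is the first proposal at every honest party, within time
`δ` after the broadcaster starts. -/
theorem exists_firstProposal (hΔ : 0 < Δ) (hδ : 0 ≤ δ)
    (h : E.IsRun (thirdBB f L Δ BA) f δ δ) {v : V} (hL : L ∉ E.byz)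
    (hv : E.input L = some v) {i : Fin n} (hi : i ∉ E.byz) :
    ∃ t, firstProposal L i (E.input i) (E.hist i) = some (t, v) ∧
      E.start i + t ≤ E.start L + δ := by
  have hex : ∃ a, IsFirstProposal L i (E.input i) (E.hist i) a v ∧
      E.start i + a ≤ E.start L + δ := by
    by_cases hiL : i = L
    · subst hiL
      exact ⟨0, Or.inl ⟨rfl, rfl, hv⟩, by linarith⟩
    · have hsent : ∀ s w, proposeMsg L w ∈ E.sent L i s → s = E.start L ∧ w = v := by
        intro s w hm
        have hs := sends_of_sent h hL (Ne.symm hiL) hm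
        refine ⟨by linarith [hs.eq_zero_of_proposeMsg], ?_⟩
        refine seen_of_honest_broadcaster h hL hv hi (w := w)
          (τ := max (s + E.delay L i s (proposeMsg L w)) (E.start i) - E.start i)
          (Or.inr ⟨(_, L, proposeMsg L w), ⟨⟨Ne.symm hiL, s, hm, rfl⟩, le_rfl⟩, ?_⟩)
        simp [sigs_proposeMsg]
      -- all proposals are sent at the same time, so there is a first one among those received
      obtain ⟨a, -, ha, hmem⟩ := exists_received h hL hi (Ne.symm hiL) le_rfl
        (lockTime_nonneg hΔ) (m := proposeMsg L v) (Or.inl ⟨rfl, rfl, v, hv, rfl⟩)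
      refine ⟨a, Or.inr ⟨hiL, hmem, fun t' w ht' => ?_⟩, by linarith⟩
      obtain ⟨-, s, hs, ha⟩ := hmem
      obtain ⟨-, s', hs', ht'⟩ := ht'
      dsimp only at hs hs' ha ht'
      obtain ⟨rfl, -⟩ := hsent s v hs
      obtain ⟨rfl, rfl⟩ := hsent s' w hs'
      rw [ha, ht']
  obtain ⟨a, ha, hle⟩ := hex
  have hsome : ∃ p : ℝ × V, firstProposal L i (E.input i) (E.hist i) = some p := by
    unfold firstProposal
    rw [dif_pos ⟨(a, v), ha⟩]
    exact ⟨_, rfl⟩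
  obtain ⟨⟨t, w⟩, hp⟩ := hsome
  obtain rfl : w = v := seen_of_honest_broadcaster h hL hv hi (τ := t)
    (seen_of_firstProposal (firstProposal_upTo hp le_rfl))
  refine ⟨t, hp, ?_⟩
  have : t ≤ a := by
    rcases isFirstProposal_of_firstProposal hp with h1 | h1 <;> rcases ha with h2 | h2
    · rw [h1.2.1, h2.2.1]
    · exact absurd h1.1 h2.1
    · exact absurd h2.1 h1.1
    · exact h1.2.2 a w h2.2.1
  linarith

/-- If the broadcaster is honest, then every honest party commits on `n - f` votes within
time `Δ + δ`. The time of the commit is the last of the expiry of the vote timer and the arrivals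
of the votes of the honest parties. -/
theorem exists_fastCommit (hΔ : 0 < Δ) (hδ : 0 ≤ δ) (hδΔ : δ ≤ Δ)
    (h : E.IsRun (thirdBB f L Δ BA) f δ δ) {v : V} (hL : L ∉ E.byz)
    (hv : E.input L = some v) {i : Fin n} (hi : i ∉ E.byz) :
    ∃ t, FastCommit f L Δ i (E.input i) (E.hist i) t v ∧
      E.start i + t ≤ E.start L + (Δ + δ) := by
  classical
  obtain ⟨t₀, ht₀, hle⟩ := exists_firstProposal hΔ hδ h hL hv hi
  have h0 := firstProposal_nonneg ht₀
  -- honest parties vote by time `δ` after the start of `L`, so their votes arrive by time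
  -- `2 δ ≤ Δ + δ`
  have hvote : ∀ k, ∃ a, k ∉ E.byz → k ≠ i →
      E.start i + a ≤ E.start L + 2 * δ ∧ (a, k, voteMsg L k v) ∈ E.hist i := by
    intro k
    by_cases hk : k ∉ E.byz ∧ k ≠ i
    · obtain ⟨s, hs, hsle⟩ := exists_firstProposal hΔ hδ h hL hv hk.1
      have hsk := (abs_le.1 (h.skew L k hL hk.1)).2
      obtain ⟨a, -, ha, hmem⟩ := exists_received h hk.1 hi hk.2 (firstProposal_nonneg hs)
        (by unfold lockTime; linarith) (m := voteMsg L k v)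
        (Or.inr (Or.inl ⟨v, firstProposal_upTo hs le_rfl, rfl⟩))
      exact ⟨a, fun _ _ => ⟨by linarith, hmem⟩⟩
    · exact ⟨0, fun h1 h2 => absurd ⟨h1, h2⟩ hk⟩
  choose a ha using hvote
  let g : Fin n → ℝ := fun k => if k ∉ E.byz ∧ k ≠ i then max (a k) (t₀ + Δ) else t₀ + Δ
  obtain ⟨k₀, -, hk₀⟩ := Finset.exists_max_image Finset.univ g ⟨L, Finset.mem_univ L⟩
  have hg : ∀ k, t₀ + Δ ≤ g k := by
    intro k
    simp only [g]
    split_ifs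
    · exact le_max_right _ _
    · exact le_rfl
  have hga : ∀ k, k ∉ E.byz → k ≠ i → a k ≤ g k := by
    intro k h1 h2
    simp only [g]
    rw [if_pos ⟨h1, h2⟩]
    exact le_max_left _ _
  have hcase : g k₀ = t₀ + Δ ∨ (k₀ ∉ E.byz ∧ k₀ ≠ i) ∧ g k₀ = a k₀ := by
    by_cases hk : k₀ ∉ E.byz ∧ k₀ ≠ i
    · rcases le_total (a k₀) (t₀ + Δ) with h1 | h1
      · left
        simp only [g]
        rw [if_pos hk, max_eq_right h1]
      · right
        refine ⟨hk, ?_⟩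
        simp only [g]
        rw [if_pos hk, max_eq_left h1]
    · left
      simp only [g]
      rw [if_neg hk]
  have hbound : E.start i + g k₀ ≤ E.start L + (Δ + δ) := by
    rcases hcase with h1 | ⟨h1, h2⟩
    · linarith
    · linarith [(ha k₀ h1.1 h1.2).1]
  refine ⟨g k₀, ⟨?_, t₀, firstProposal_upTo ht₀ (by linarith [hg k₀]), hg k₀, ?_, ?_, ?_⟩,
    hbound⟩
  · have hsk := (abs_le.1 (h.skew L i hL hi)).2
    unfold commitDeadline
    linarith
  · rintro ⟨w, w', hne, hw, hw'⟩
    rw [seen_of_honest_broadcaster h hL hv hi hw,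
      seen_of_honest_broadcaster h hL hv hi hw'] at hne
    exact hne rfl
  · have hsub : ((E.byzᶜ : Finset (Fin n)) : Set (Fin n)) ⊆
        {k | HasVote L i (E.input i) ((E.hist i).upTo (g k₀)) k v} := by
      intro k hk
      have hk : k ∉ E.byz := by simpa using hk
      by_cases hki : k = i
      · exact Or.inr ⟨hki, t₀, firstProposal_upTo ht₀ (by linarith [hg k₀])⟩
      · exact Or.inl ⟨a k, k, (ha k hk hki).2,
          (hga k hk hki).trans (hk₀ k (Finset.mem_univ k))⟩
    have h1 := Set.ncard_le_ncard hsub (Set.toFinite _)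
    rw [Set.ncard_coe_finset, Finset.card_compl, Fintype.card_fin] at h1
    have h2 := h.faults
    unfold Quorum
    omega
  · rcases hcase with h1 | ⟨h1, h2⟩
    · exact Or.inl h1
    · right
      rw [h2]
      exact ⟨k₀, k₀, (ha k₀ h1.1 h1.2).2⟩

end Upper

theorem solvesBB_thirdBB {n : ℕ} {V D : Type*} {f : ℕ} {L : Fin n} {Δ : ℝ} (hΔ : 0 < Δ)
    (hf : 3 * f ≤ n) {BA : Protocol n D (Option V) (Option V)} (hBA : SolvesBA BA f Δ Δ) :
    SolvesBB (thirdBB f L Δ BA) L f Δ Δ where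
  agreement E v h _ := agreement_thirdBB hΔ hf hBA h
  validity E v h hin hL i hi := by
    obtain ⟨t, ht, -⟩ := exists_fastCommit hΔ hΔ.le le_rfl h hL
      (v := v) (by rw [hin]; simp [broadcastInput]) hi
    exact ⟨⟨_, ht.commits hΔ h hi⟩, terminates_thirdBB hΔ hBA h hi⟩
  termination E v h _ i hi :=
    ⟨exists_commits_thirdBB hΔ hBA h hi, terminates_thirdBB hΔ hBA h hi⟩

theorem hasGoodCaseLatency_thirdBB {n : ℕ} {V D : Type*} {f : ℕ} {L : Fin n} {Δ δ : ℝ}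
    (hΔ : 0 < Δ) (hδ : 0 ≤ δ) (hδΔ : δ ≤ Δ) (BA : Protocol n D (Option V) (Option V)) :
    HasGoodCaseLatency (thirdBB f L Δ BA) L f δ δ (Δ + δ) := by
  intro E v h hin hL i hi
  obtain ⟨t, ht, hle⟩ := exists_fastCommit hΔ hδ hδΔ h hL
    (v := v) (by rw [hin]; simp [broadcastInput]) hi
  exact ⟨_, _, hle, ht.commits hΔ (h.mono hδΔ hδΔ) hi⟩

end ThirdBB

end GoodCase

namespace GoodCase

/-! ### Construction of executions -/

namespace Execution

section Construction

variable {n : ℕ} {D I O : Type*}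

theorem view_congr {E E' : Execution n D I} {i : Fin n} {t : ℝ}
    (hst : E.start i = E'.start i) (hd : ∀ j s m, E.delay j i s m = E'.delay j i s m)
    (h : ∀ j s m, j ≠ i → s + E.delay j i s m ≤ t →
      (m ∈ E.sent j i s ↔ m ∈ E'.sent j i s)) :
    E.view i t = E'.view i t := by
  ext e
  simp only [view, Set.mem_ofPred_eq, hst]
  refine and_congr_right fun hne => exists_congr fun s => ?_
  rw [hd]
  have key : e.1 = max (s + E'.delay e.2.1 i s e.2.2) (E'.start i) - E'.start i →
      e.1 ≤ t - E'.start i → s + E.delay e.2.1 i s e.2.2 ≤ t := by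
    intro h1 h2
    rw [hd]
    linarith [le_max_left (s + E'.delay e.2.1 i s e.2.2) (E'.start i)]
  constructor
  · rintro ⟨h1, h2, h3⟩
    exact ⟨(h _ _ _ hne (key h2 h3)).1 h1, h2, h3⟩
  · rintro ⟨h1, h2, h3⟩
    exact ⟨(h _ _ _ hne (key h2 h3)).2 h1, h2, h3⟩

theorem view_eq_empty {E : Execution n D I} {i : Fin n} {t : ℝ}
    (h : ∀ j s m, j ≠ i → m ∈ E.sent j i s → t < s + E.delay j i s m) :
    E.view i t = ∅ := by
  refine Set.eq_empty_of_forall_notMem fun e he => ?_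
  obtain ⟨hne, s, h1, h2⟩ := exists_sent_of_mem_view he
  exact (h _ _ _ hne h1).not_ge h2

/-- What party `i` has to send to `j` at time `s` when it follows `P`. -/
def prescribed (E : Execution n D I) (P : Protocol n D I O) (i j : Fin n) (s : ℝ) :
    Set (Term n D) :=
  {m | E.start i ≤ s ∧ E.Active P i s ∧
    m ∈ P.send i (E.input i) (E.view i s) (s - E.start i) j}

theorem active_congr {E E' : Execution n D I} {P : Protocol n D I O} {i : Fin n} {t : ℝ}
    (hst : E.start i = E'.start i) (hx : E.input i = E'.input i)
    (hv : ∀ t', t' < t → E.view i t' = E'.view i t') : E.Active P i t ↔ E'.Active P i t := by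
  unfold Active
  rw [hst, hx]
  refine forall_congr' fun t' => imp_congr_right fun _ => forall_congr' fun ht => ?_
  rw [hv t' ht]

theorem prescribed_congr {E E' : Execution n D I} {P : Protocol n D I O} {i : Fin n} {s : ℝ}
    (hst : E.start i = E'.start i) (hx : E.input i = E'.input i)
    (hv : ∀ t, t ≤ s → E.view i t = E'.view i t) (j : Fin n) :
    E.prescribed P i j s = E'.prescribed P i j s := by
  unfold prescribed
  rw [active_congr hst hx fun t ht => hv t ht.le, hv s le_rfl, hst, hx]

/-- If messages are sent at non-negative times only and the delays are bounded from below by a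
positive number, then backward chains of messages are finite. -/
theorem causal_of_le_delay {E : Execution n D I} {δ : ℝ} (hδ : 0 < δ)
    (hd : ∀ i j s m, δ ≤ E.delay i j s m)
    (h0 : ∀ i j s m, i ≠ j → m ∈ E.sent i j s → 0 ≤ s) : WellFounded E.Influences := by
  refine Subrelation.wf (r := InvImage (· < ·) fun x : Option (Fin n) × ℝ => ⌊x.2 / δ⌋₊) ?_
    (InvImage.wf _ wellFounded_lt)
  rintro x y ⟨i, j, m, hij, -, -, -, hm, hle⟩
  have hx := h0 i j x.2 m hij hm
  have h1 : x.2 / δ + 1 ≤ y.2 / δ := by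
    rw [← div_self hδ.ne', ← add_div]
    exact div_le_div_of_nonneg_right (by linarith [hd i j x.2 m]) hδ.le
  have h2 : ⌊x.2 / δ⌋₊ + 1 ≤ ⌊y.2 / δ⌋₊ := by
    rw [← Nat.floor_add_one (div_nonneg hx hδ.le)]
    exact Nat.floor_le_floor h1
  exact h2

/-- Approximations to the execution in which the Byzantine parties behave as in `E` and the honest
parties follow `P`: in each of them, the honest parties react to what they receive in the one
before. -/
def stage (P : Protocol n D I O) (E : Execution n D I) : ℕ → Execution n D I
  | 0 => E
  | k + 1 => { E with
      sent := fun i j s =>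
        {m | (i ∈ E.byz ∧ m ∈ E.sent i j s) ∨
          (i ∉ E.byz ∧ m ∈ (stage P E k).prescribed P i j s)} }

/-- The execution in which the Byzantine parties behave as in `E` and the honest parties
follow `P`. When all delays are at least `δ > 0`, what happens before time `k * δ` is final
in every approximation after the `k`-th. -/
noncomputable def unroll (P : Protocol n D I O) (δ : ℝ) (E : Execution n D I) :
    Execution n D I :=
  { E with sent := fun i j s => (stage P E (⌊s / δ⌋₊ + 2)).sent i j s }

variable {P : Protocol n D I O} {E : Execution n D I} {δ : ℝ}

theorem stage_start (k : ℕ) : (stage P E k).start = E.start := by cases k <;> rfl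

theorem stage_input (k : ℕ) : (stage P E k).input = E.input := by cases k <;> rfl

theorem stage_delay (k : ℕ) : (stage P E k).delay = E.delay := by cases k <;> rfl

theorem stage_sent_succ (hst : ∀ i, E.start i = 0)
    (hd : ∀ i j s m, δ ≤ E.delay i j s m) (k : ℕ) : ∀ (i j : Fin n) (s : ℝ), s < k * δ →
      (stage P E (k + 2)).sent i j s = (stage P E (k + 1)).sent i j s := by
  induction k with
  | zero =>
    intro i j s hs
    have hs : ¬ 0 ≤ s := by simpa using hs
    ext m
    simp [stage, prescribed, hst, hs]
  | succ k ih =>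
    intro i j s hs
    have key : (stage P E (k + 2)).prescribed P i j s = (stage P E (k + 1)).prescribed P i j s := by
      refine prescribed_congr (by simp only [stage_start]) (by simp only [stage_input])
        (fun t ht => view_congr (by simp only [stage_start])
          (fun _ _ _ => by simp only [stage_delay]) fun j' s' m _ hs' => ?_) j
      rw [stage_delay] at hs'
      push_cast at hs
      rw [ih j' i s' (by linarith [hd j' i s' m])]
    ext m
    change (_ ∧ _ ∨ _ ∧ m ∈ (stage P E (k + 2)).prescribed P i j s) ↔
      (_ ∧ _ ∨ _ ∧ m ∈ (stage P E (k + 1)).prescribed P i j s)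
    rw [key]

theorem stage_sent_eq (hδ : 0 < δ) (hst : ∀ i, E.start i = 0)
    (hd : ∀ i j s m, δ ≤ E.delay i j s m) {k l : ℕ} (hkl : k ≤ l) (i j : Fin n) {s : ℝ}
    (hs : s < k * δ) : (stage P E (l + 1)).sent i j s = (stage P E (k + 1)).sent i j s := by
  induction l, hkl using Nat.le_induction with
  | base => rfl
  | succ l hl ih =>
    rw [← ih]
    refine stage_sent_succ hst hd l i j s (hs.trans_le ?_)
    exact mul_le_mul_of_nonneg_right (by exact_mod_cast hl) hδ.le

theorem unroll_sent_eq (hδ : 0 < δ) (hst : ∀ i, E.start i = 0)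
    (hd : ∀ i j s m, δ ≤ E.delay i j s m) {k : ℕ} (i j : Fin n) {s : ℝ} (hs : s < k * δ) :
    (unroll P δ E).sent i j s = (stage P E (k + 1)).sent i j s := by
  have h1 : s < ((⌊s / δ⌋₊ + 1 : ℕ) : ℝ) * δ := by
    rw [← div_lt_iff₀ hδ]
    exact_mod_cast Nat.lt_floor_add_one (s / δ)
  change (stage P E (⌊s / δ⌋₊ + 1 + 1)).sent i j s = _
  rcases le_total (⌊s / δ⌋₊ + 1) k with h | h
  · exact (stage_sent_eq hδ hst hd h i j h1).symm
  · exact stage_sent_eq hδ hst hd h i j hs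

theorem unroll_sent_byz {i : Fin n} (hi : i ∈ E.byz) (j : Fin n) (s : ℝ) :
    (unroll P δ E).sent i j s = E.sent i j s := by
  ext m
  simp [unroll, stage, hi]

theorem unroll_sent_honest (hδ : 0 < δ) (hst : ∀ i, E.start i = 0)
    (hd : ∀ i j s m, δ ≤ E.delay i j s m) {i : Fin n} (hi : i ∉ E.byz) (j : Fin n) (s : ℝ) :
    (unroll P δ E).sent i j s = (unroll P δ E).prescribed P i j s := by
  have h1 : s < ((⌊s / δ⌋₊ + 1 : ℕ) : ℝ) * δ := by
    rw [← div_lt_iff₀ hδ]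
    exact_mod_cast Nat.lt_floor_add_one (s / δ)
  have h2 : (stage P E (⌊s / δ⌋₊ + 1 + 1)).prescribed P i j s =
      (unroll P δ E).prescribed P i j s := by
    refine prescribed_congr (by rw [stage_start]; rfl) (by rw [stage_input]; rfl)
      (fun t ht => view_congr (by rw [stage_start]; rfl)
        (fun _ _ _ => by rw [stage_delay]; rfl) fun j' s' m _ hs' => ?_) j
    rw [stage_delay] at hs'
    rw [unroll_sent_eq hδ hst hd j' i (s := s') (by linarith [hd j' i s' m])]
  have h3 : s < ((⌊s / δ⌋₊ + 1 + 1 : ℕ) : ℝ) * δ := by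
    push_cast at h1 ⊢
    linarith
  rw [unroll_sent_eq hδ hst hd i j h3, ← h2]
  ext m
  simp [stage, hi]

end Construction

end Execution

/-! ### The lower bound -/

section Lower

open Execution

variable {n : ℕ} {D I O : Type*}

/-- The delays in the lower bound: `Δ` between the groups `A` and `B`, and `δ` otherwise. -/
def groupDelay (A B : Finset (Fin n)) (δ Δ : ℝ) (i j : Fin n) : ℝ :=
  if (i ∈ A ∧ j ∈ B) ∨ (i ∈ B ∧ j ∈ A) then Δ else δ

theorem groupDelay_comm (A B : Finset (Fin n)) (δ Δ : ℝ) :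
    groupDelay A B δ Δ = groupDelay B A δ Δ := by
  funext i j
  simp only [groupDelay, or_comm]

theorem le_groupDelay {A B : Finset (Fin n)} {δ Δ : ℝ} (hδΔ : δ ≤ Δ) (i j : Fin n) :
    δ ≤ groupDelay A B δ Δ i j := by
  unfold groupDelay
  split_ifs
  · exact hδΔ
  · exact le_rfl

theorem groupDelay_le {A B : Finset (Fin n)} {δ Δ : ℝ} (hδΔ : δ ≤ Δ) (i j : Fin n) :
    groupDelay A B δ Δ i j ≤ Δ := by
  unfold groupDelay
  split_ifs
  · exact le_rfl
  · exact hδΔ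

/-- The execution with inputs `x` in which `B` is Byzantine. Towards `A`, the parties of `B` behave
before time `δ` like honest parties that have received nothing; otherwise they are silent. -/
noncomputable def silentRun (Q : Protocol n D I O) (A B : Finset (Fin n)) (δ Δ : ℝ)
    (x : Fin n → I) : Execution n D I :=
  unroll Q δ
    { byz := B
      input := x
      start := fun _ => 0
      sent := fun i j s => {m | j ∈ A ∧ 0 ≤ s ∧ s < δ ∧
        (∀ t, 0 ≤ t → t < s → ¬ Q.halt i (x i) ∅ t) ∧ m ∈ Q.send i (x i) ∅ s j}
      delay := fun i j _ _ => groupDelay A B δ Δ i j }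

variable {Q : Protocol n D I O} {A B C : Finset (Fin n)} {f : ℕ} {δ Δ : ℝ} {x : Fin n → I}

theorem silentRun_sent_byz {i : Fin n} (hi : i ∈ B) (j : Fin n) (s : ℝ) :
    (silentRun Q A B δ Δ x).sent i j s = {m | j ∈ A ∧ 0 ≤ s ∧ s < δ ∧
      (∀ t, 0 ≤ t → t < s → ¬ Q.halt i (x i) ∅ t) ∧ m ∈ Q.send i (x i) ∅ s j} :=
  unroll_sent_byz hi j s

theorem silentRun_sent_honest (hδ : 0 < δ) (hδΔ : δ ≤ Δ) {i : Fin n} (hi : i ∉ B) (j : Fin n)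
    (s : ℝ) : (silentRun Q A B δ Δ x).sent i j s =
      (silentRun Q A B δ Δ x).prescribed Q i j s :=
  unroll_sent_honest hδ (fun _ => rfl) (fun i j _ _ => le_groupDelay hδΔ i j) hi j s

theorem silentRun_sent_nonneg (hδ : 0 < δ) (hδΔ : δ ≤ Δ) {i j : Fin n} {s : ℝ} {m : Term n D}
    (hm : m ∈ (silentRun Q A B δ Δ x).sent i j s) : 0 ≤ s := by
  by_cases hi : i ∈ B
  · rw [silentRun_sent_byz hi] at hm
    exact hm.2.1
  · rw [silentRun_sent_honest hδ hδΔ hi] at hm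
    exact hm.1

theorem isRun_silentRun (hδ : 0 < δ) (hδΔ : δ ≤ Δ) (hB : B.card ≤ f) :
    (silentRun Q A B δ Δ x).IsRun Q f δ 0 where
  faults := hB
  skew i j _ _ := by simp [silentRun, unroll]
  delay_nonneg i j _ _ := hδ.le.trans (le_groupDelay hδΔ i j)
  delay_le i j s m hi hj := by
    change groupDelay A B δ Δ i j ≤ δ
    have hi : i ∉ B := hi
    have hj : j ∉ B := hj
    simp [groupDelay, hi, hj]
  honest i j s hi _ := silentRun_sent_honest hδ hδΔ hi j s
  unforgeable b j s m hb _ hm k u hk hu := by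
    have hb : b ∈ B := hb
    rw [silentRun_sent_byz hb] at hm
    obtain ⟨e, he, -⟩ := Q.authentic b _ _ _ j m hm.2.2.2.2 k u hu fun h => hk (h ▸ hb)
    exact absurd he (Set.notMem_empty e)
  causal := causal_of_le_delay hδ (fun i j _ _ => le_groupDelay hδΔ i j)
    fun i j s m _ hm => silentRun_sent_nonneg hδ hδΔ hm

/-- In `E` the parties of `A` and `B` follow `Q`, and those of `C` send to the parties of `A` what
they send in the execution `silentRun Q A B δ Δ x`, as long as it arrives before time `Δ + δ`. -/
structure Replay (Q : Protocol n D I O) (A B C : Finset (Fin n)) (δ Δ : ℝ) (x : Fin n → I)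
    (E : Execution n D I) : Prop where
  start : ∀ i, E.start i = 0
  delay : ∀ i j s m, E.delay i j s m = groupDelay A B δ Δ i j
  input : ∀ i, i ∉ C → E.input i = x i
  honest : ∀ i j s, i ∉ C → E.sent i j s = E.prescribed Q i j s
  replay : ∀ c a s, c ∈ C → a ∈ A →
    E.sent c a s = {m | s < Δ ∧ m ∈ (silentRun Q A B δ Δ x).sent c a s}
  nonneg : ∀ i j s m, m ∈ E.sent i j s → 0 ≤ s
  cover : ∀ i, i ∈ A ∨ i ∈ B ∨ i ∈ C
  disjAB : Disjoint A B
  disjAC : Disjoint A C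
  disjBC : Disjoint B C

/-- Before time `Δ + δ` the parties of `A` cannot tell `E` from the execution in which `B` is
Byzantine: until then nothing has reached them from `B` that was sent at time `δ` or later. -/
theorem Replay.view_eq (hδ : 0 < δ) (hδΔ : δ ≤ Δ) {E : Execution n D I}
    (h : Replay Q A B C δ Δ x E) {a : Fin n} (ha : a ∈ A) {t : ℝ} (ht : t < Δ + δ) :
    E.view a t = (silentRun Q A B δ Δ x).view a t := by
  suffices H : ∀ k : ℕ, ∀ a ∈ A, ∀ t, t < k * δ → t < Δ + δ →
      E.view a t = (silentRun Q A B δ Δ x).view a t by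
    obtain ⟨k, hk⟩ := exists_nat_gt (t / δ)
    exact H k a ha t ((div_lt_iff₀ hδ).1 hk) ht
  intro k
  induction k with
  | zero =>
    intro a _ t ht _
    have ht : t < 0 := by simpa using ht
    rw [view_eq_empty, view_eq_empty]
    · intro j s m _ hm
      have h1 := silentRun_sent_nonneg hδ hδΔ hm
      have h2 : δ ≤ (silentRun Q A B δ Δ x).delay j a s m := le_groupDelay hδΔ j a
      linarith
    · intro j s m _ hm
      have h1 := h.nonneg _ _ _ _ hm
      have h2 := le_groupDelay (A := A) (B := B) hδΔ j a
      rw [h.delay]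
      linarith
  | succ k ih =>
    intro a ha t ht htΔ
    push_cast at ht
    refine view_congr (h.start a) (fun j s m => h.delay j a s m) fun j s m _ hs => ?_
    rw [h.delay] at hs
    have haB : a ∉ B := Finset.disjoint_left.1 h.disjAB ha
    rcases h.cover j with hj | hj | hj
    · have hjB : j ∉ B := Finset.disjoint_left.1 h.disjAB hj
      have hd := le_groupDelay (A := A) (B := B) hδΔ j a
      rw [h.honest j a s (Finset.disjoint_left.1 h.disjAC hj),
        silentRun_sent_honest hδ hδΔ hjB]
      rw [prescribed_congr (E' := silentRun Q A B δ Δ x) (h.start j)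
        (h.input j (Finset.disjoint_left.1 h.disjAC hj))
        fun t' ht' => ih j hj t' (by linarith) (by linarith)]
    · -- the message was sent before time `δ`, when `j` had not received anything
      have hd : groupDelay A B δ Δ j a = Δ := if_pos (Or.inr ⟨hj, ha⟩)
      have hsδ : s < δ := by linarith
      have hempty : ∀ t', t' ≤ s → E.view j t' = ∅ := by
        intro t' ht'
        refine view_eq_empty fun j' s' m' _ hm' => ?_
        have h1 := h.nonneg _ _ _ _ hm'
        have h2 := le_groupDelay (A := A) (B := B) hδΔ j' j
        rw [h.delay]
        linarith
      have hjC : j ∉ C := Finset.disjoint_left.1 h.disjBC hj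
      rw [h.honest j a s hjC, silentRun_sent_byz hj]
      simp only [prescribed, Active, Set.mem_ofPred_eq, h.start, h.input j hjC,
        hempty s le_rfl, sub_zero]
      constructor
      · rintro ⟨h1, h2, h3⟩
        refine ⟨ha, h1, hsδ, fun t' h4 h5 => ?_, h3⟩
        rw [← hempty t' h5.le]
        exact h2 t' h4 h5
      · rintro ⟨-, h1, -, h2, h3⟩
        refine ⟨h1, fun t' h4 h5 => ?_, h3⟩
        rw [hempty t' h5.le]
        exact h2 t' h4 h5
    · have hd := le_groupDelay (A := A) (B := B) hδΔ j a
      rw [h.replay j a s hj ha]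
      exact ⟨fun hm => hm.2, fun hm => ⟨by linarith, hm⟩⟩

theorem Replay.sent_eq (hδ : 0 < δ) (hδΔ : δ ≤ Δ) {E : Execution n D I}
    (h : Replay Q A B C δ Δ x E) {a : Fin n} (ha : a ∈ A) (j : Fin n) {s : ℝ}
    (hs : s < Δ + δ) : E.sent a j s = (silentRun Q A B δ Δ x).sent a j s := by
  have haC := Finset.disjoint_left.1 h.disjAC ha
  rw [h.honest a j s haC,
    silentRun_sent_honest hδ hδΔ (Finset.disjoint_left.1 h.disjAB ha)]
  exact prescribed_congr (E' := silentRun Q A B δ Δ x) (h.start a) (h.input a haC)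
    (fun t ht => h.view_eq hδ hδΔ ha (by linarith)) j

theorem Replay.commits (hδ : 0 < δ) (hδΔ : δ ≤ Δ) {E : Execution n D I}
    (h : Replay Q A B C δ Δ x E) {a : Fin n} (ha : a ∈ A) {t : ℝ} (ht : t < Δ + δ) {o : O}
    (hc : (silentRun Q A B δ Δ x).Commits Q a t o) : E.Commits Q a t o := by
  have hx := h.input a (Finset.disjoint_left.1 h.disjAC ha)
  obtain ⟨h1, h2, h3⟩ := hc
  refine ⟨by rw [h.start]; exact h1, ?_, ?_⟩
  · exact (active_congr (E' := silentRun Q A B δ Δ x) (h.start a) hx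
      fun t' ht' => h.view_eq hδ hδΔ ha (ht'.trans ht)).2 h2
  · rw [h.view_eq hδ hδΔ ha ht, h.start, hx]
    exact h3

/-- The parties of `C` can replay: every foreign signature that they need has reached them from
`A`. -/
theorem Replay.unforgeable (hδ : 0 < δ) (hδΔ : δ ≤ Δ) {E : Execution n D I}
    (h : Replay Q A B C δ Δ x E) (hB : B.card ≤ f) {c a : Fin n} (hc : c ∈ C) (ha : a ∈ A)
    {s : ℝ} {m : Term n D} (hm : m ∈ E.sent c a s) {k : Fin n} {u : Term n D} (hk : k ∉ C)
    (hu : (k, u) ∈ m.sigs) :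
    ∃ i c' s' m', i ∉ C ∧ c' ∈ C ∧ m' ∈ E.sent i c' s' ∧ s' + E.delay i c' s' m' ≤ s ∧
      (k, u) ∈ m'.sigs := by
  rw [h.replay c a s hc ha] at hm
  have hca : c ≠ a := fun e => Finset.disjoint_left.1 h.disjAC ha (e ▸ hc)
  obtain ⟨i, c', s', m', hi, hc', hm', hs', hu'⟩ :=
    (isRun_silentRun (x := x) (A := A) (Q := Q) hδ hδΔ hB).exists_entry (C := C)
      (fun c hc => Finset.disjoint_right.1 h.disjBC hc) hk hc hca hm.2 hu
  have hs' : s' + groupDelay A B δ Δ i c' ≤ s := hs'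
  refine ⟨i, c', s', m', hi, hc', ?_, by rw [h.delay]; exact hs', hu'⟩
  have hd := le_groupDelay (A := A) (B := B) hδΔ i c'
  rcases h.cover i with hi' | hi' | hi'
  · rw [h.sent_eq hδ hδΔ hi' c' (by linarith [hm.1])]
    exact hm'
  · rw [silentRun_sent_byz hi'] at hm'
    exact absurd hc' (Finset.disjoint_left.1 h.disjAC hm'.1)
  · exact absurd hi' hi

/-- The execution in which `C` is Byzantine and shows to `A` the execution with inputs `x` in which
`B` is silent, and to `B` the execution with inputs `y` in which `A` is silent. -/
noncomputable def splitRun (Q : Protocol n D I O) (A B C : Finset (Fin n)) (δ Δ : ℝ)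
    (x y : Fin n → I) : Execution n D I :=
  unroll Q δ
    { byz := C
      input := x
      start := fun _ => 0
      sent := fun i j s => {m | s < Δ ∧ ((j ∈ A ∧ m ∈ (silentRun Q A B δ Δ x).sent i j s) ∨
        (j ∈ B ∧ m ∈ (silentRun Q B A δ Δ y).sent i j s))}
      delay := fun i j _ _ => groupDelay A B δ Δ i j }

theorem splitRun_sent_byz {y : Fin n → I} {i : Fin n} (hi : i ∈ C) (j : Fin n) (s : ℝ) :
    (splitRun Q A B C δ Δ x y).sent i j s =
      {m | s < Δ ∧ ((j ∈ A ∧ m ∈ (silentRun Q A B δ Δ x).sent i j s) ∨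
        (j ∈ B ∧ m ∈ (silentRun Q B A δ Δ y).sent i j s))} :=
  unroll_sent_byz hi j s

theorem splitRun_sent_honest (hδ : 0 < δ) (hδΔ : δ ≤ Δ) {y : Fin n → I} {i : Fin n}
    (hi : i ∉ C) (j : Fin n) (s : ℝ) : (splitRun Q A B C δ Δ x y).sent i j s =
      (splitRun Q A B C δ Δ x y).prescribed Q i j s :=
  unroll_sent_honest hδ (fun _ => rfl) (fun i j _ _ => le_groupDelay hδΔ i j) hi j s

theorem splitRun_sent_nonneg (hδ : 0 < δ) (hδΔ : δ ≤ Δ) {y : Fin n → I} {i j : Fin n} {s : ℝ}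
    {m : Term n D} (hm : m ∈ (splitRun Q A B C δ Δ x y).sent i j s) : 0 ≤ s := by
  by_cases hi : i ∈ C
  · rw [splitRun_sent_byz hi] at hm
    rcases hm.2 with h | h
    · exact silentRun_sent_nonneg hδ hδΔ h.2
    · exact silentRun_sent_nonneg hδ hδΔ h.2
  · rw [splitRun_sent_honest hδ hδΔ hi] at hm
    exact hm.1

theorem replay_splitRun_left (hδ : 0 < δ) (hδΔ : δ ≤ Δ) {y : Fin n → I}
    (cover : ∀ i, i ∈ A ∨ i ∈ B ∨ i ∈ C) (hAB : Disjoint A B) (hAC : Disjoint A C)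
    (hBC : Disjoint B C) : Replay Q A B C δ Δ x (splitRun Q A B C δ Δ x y) where
  start _ := rfl
  delay _ _ _ _ := rfl
  input _ _ := rfl
  honest _ j s hi := splitRun_sent_honest hδ hδΔ hi j s
  replay c a s hc ha := by
    have haB := Finset.disjoint_left.1 hAB ha
    ext m
    simp [splitRun_sent_byz hc, ha, haB]
  nonneg _ _ _ _ hm := splitRun_sent_nonneg hδ hδΔ hm
  cover := cover
  disjAB := hAB
  disjAC := hAC
  disjBC := hBC

theorem replay_splitRun_right (hδ : 0 < δ) (hδΔ : δ ≤ Δ) {y : Fin n → I}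
    (hxy : ∀ i, i ∉ C → x i = y i)
    (cover : ∀ i, i ∈ A ∨ i ∈ B ∨ i ∈ C) (hAB : Disjoint A B) (hAC : Disjoint A C)
    (hBC : Disjoint B C) : Replay Q B A C δ Δ y (splitRun Q A B C δ Δ x y) where
  start _ := rfl
  delay _ _ _ _ := by
    rw [groupDelay_comm B A]
    rfl
  input i hi := hxy i hi
  honest _ j s hi := splitRun_sent_honest hδ hδΔ hi j s
  replay c b s hc hb := by
    have hbA := Finset.disjoint_right.1 hAB hb
    ext m
    simp [splitRun_sent_byz hc, hb, hbA]
  nonneg _ _ _ _ hm := splitRun_sent_nonneg hδ hδΔ hm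
  cover i := by
    rcases cover i with h | h | h
    · exact Or.inr (Or.inl h)
    · exact Or.inl h
    · exact Or.inr (Or.inr h)
  disjAB := hAB.symm
  disjAC := hBC
  disjBC := hAC

theorem isRun_splitRun (hδ : 0 < δ) (hδΔ : δ ≤ Δ) {y : Fin n → I}
    (hA : A.card ≤ f) (hB : B.card ≤ f) (hC : C.card ≤ f)
    (hl : Replay Q A B C δ Δ x (splitRun Q A B C δ Δ x y))
    (hr : Replay Q B A C δ Δ y (splitRun Q A B C δ Δ x y)) :
    (splitRun Q A B C δ Δ x y).IsRun Q f Δ 0 where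
  faults := hC
  skew i j _ _ := by simp [splitRun, unroll]
  delay_nonneg i j _ _ := hδ.le.trans (le_groupDelay hδΔ i j)
  delay_le i j _ _ _ _ := groupDelay_le hδΔ i j
  honest i j s hi _ := splitRun_sent_honest hδ hδΔ hi j s
  unforgeable b j s m hb hj hm k u hk hu := by
    rcases hl.cover j with h | h | h
    · exact hl.unforgeable hδ hδΔ hB hb h hm hk hu
    · exact hr.unforgeable hδ hδΔ hA hb h hm hk hu
    · exact absurd h hj
  causal := causal_of_le_delay hδ (fun i j _ _ => le_groupDelay hδΔ i j)
    fun i j s m _ hm => splitRun_sent_nonneg hδ hδΔ hm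

/-- In the execution in which `B` is silent and the broadcaster is honest, a party of `A`
commits the broadcaster's value within the good-case latency. -/
theorem exists_commits_silentRun {V : Type*} {Q : Protocol n D (Option V) (Option V)} {L : Fin n}
    {T : ℝ} (hQ : SolvesBRB Q L f Δ 0) (hT : HasGoodCaseLatency Q L f δ 0 T) (hδ : 0 < δ)
    (hδΔ : δ ≤ Δ) (hB : B.card ≤ f) (hL : L ∉ B) (v : V) {a : Fin n} (ha : a ∉ B) :
    ∃ t, t ≤ T ∧ (silentRun Q A B δ Δ (broadcastInput L v)).Commits Q a t (some v) := by
  have hrun := isRun_silentRun (Q := Q) (A := A) (x := broadcastInput L v) hδ hδΔ hB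
  obtain ⟨t, o, ht, hc⟩ := hT _ v hrun rfl hL a ha
  have hrun' := hrun.mono hδΔ le_rfl
  obtain ⟨⟨t', hc'⟩, -⟩ := hQ.validity _ v hrun' rfl hL a ha
  rw [hQ.agreement _ v hrun' rfl a a _ _ _ _ ha ha hc hc'] at hc
  have h0 : (silentRun Q A B δ Δ (broadcastInput L v)).start L = 0 := rfl
  exact ⟨t, by linarith, hc⟩

theorem exists_partition {f : ℕ} (hn : n = 3 * f) (L : Fin n) :
    ∃ A B C : Finset (Fin n), A.card = f ∧ B.card = f ∧ C.card = f ∧ L ∈ C ∧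
      (∀ i, i ∈ A ∨ i ∈ B ∨ i ∈ C) ∧ Disjoint A B ∧ Disjoint A C ∧ Disjoint B C := by
  have hpos : 1 ≤ f := by
    have := L.pos
    omega
  obtain ⟨C, hLC, -, hC⟩ := Finset.exists_subsuperset_card_eq
    (Finset.subset_univ ({L} : Finset (Fin n))) (by simpa using hpos)
    (by rw [Finset.card_univ, Fintype.card_fin]; omega)
  have hCc : Cᶜ.card = 2 * f := by
    rw [Finset.card_compl, Fintype.card_fin]
    omega
  obtain ⟨A, hAC, hA⟩ := Finset.exists_subset_card_eq (s := Cᶜ) (n := f) (by omega)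
  refine ⟨A, Cᶜ \ A, C, hA, ?_, hC, hLC (Finset.mem_singleton_self L), ?_,
    Finset.disjoint_sdiff, ?_, ?_⟩
  · rw [Finset.card_sdiff_of_subset hAC]
    omega
  · intro i
    by_cases hi : i ∈ A
    · exact Or.inl hi
    · by_cases hi' : i ∈ C
      · exact Or.inr (Or.inr hi')
      · exact Or.inr (Or.inl (by simp [hi, hi']))
  · exact Finset.disjoint_left.2 fun i hi hi' => Finset.mem_compl.1 (hAC hi) hi'
  · exact Finset.disjoint_left.2 fun i hi hi' =>
      Finset.mem_compl.1 (Finset.mem_sdiff.1 hi).1 hi'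

theorem le_goodCaseLatency {V : Type*} [Nontrivial V] {L : Fin n}
    {Q : Protocol n D (Option V) (Option V)} (hn : n = 3 * f) (hQ : SolvesBRB Q L f Δ 0)
    {T : ℝ} (hδ : 0 < δ) (hδΔ : δ ≤ Δ) (hT : HasGoodCaseLatency Q L f δ 0 T) :
    Δ + δ ≤ T := by
  by_contra hlt
  push Not at hlt
  obtain ⟨v, w, hvw⟩ := exists_pair_ne V
  obtain ⟨A, B, C, hA, hB, hC, hLC, hcover, hAB, hAC, hBC⟩ := exists_partition hn L
  have hpos : 0 < f := by
    have := L.pos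
    omega
  obtain ⟨a, ha⟩ := Finset.card_pos.1 (hA.symm ▸ hpos)
  obtain ⟨b, hb⟩ := Finset.card_pos.1 (hB.symm ▸ hpos)
  have hxy : ∀ i, i ∉ C → broadcastInput L v i = broadcastInput L w i := by
    intro i hi
    have hiL : i ≠ L := fun e => hi (e ▸ hLC)
    simp [broadcastInput, hiL]
  have hl := replay_splitRun_left (Q := Q) (x := broadcastInput L v)
    (y := broadcastInput L w) hδ hδΔ hcover hAB hAC hBC
  have hr := replay_splitRun_right (Q := Q) (x := broadcastInput L v)
    (y := broadcastInput L w) hδ hδΔ hxy hcover hAB hAC hBC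
  have hrun := isRun_splitRun hδ hδΔ hA.le hB.le hC.le hl hr
  obtain ⟨t, ht, hct⟩ := exists_commits_silentRun (A := A) hQ hT hδ hδΔ hB.le
    (Finset.disjoint_right.1 hBC hLC) v (Finset.disjoint_left.1 hAB ha)
  obtain ⟨t', ht', hct'⟩ := exists_commits_silentRun (A := B) hQ hT hδ hδΔ hA.le
    (Finset.disjoint_right.1 hAC hLC) w (Finset.disjoint_right.1 hAB hb)
  have := hQ.agreement _ v hrun rfl a b t t' _ _ (Finset.disjoint_left.1 hAC ha)
    (Finset.disjoint_left.1 hBC hb) (hl.commits hδ hδΔ ha (ht.trans_lt hlt) hct)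
    (hr.commits hδ hδΔ hb (ht'.trans_lt hlt) hct')
  exact hvw (Option.some.inj this)

end Lower

end GoodCase

theorem mainTheorem7 {V : Type*} {n : ℕ} (f : ℕ) (L : Fin n) (Δ : ℝ) (hΔ : 0 < Δ)
    (hf : 3 * f ≤ n) :
    (∀ {D : Type*} (BA : GoodCase.Protocol n D (Option V) (Option V)),
      GoodCase.SolvesBA BA f Δ Δ →
        GoodCase.SolvesBB (GoodCase.thirdBB f L Δ BA) L f Δ Δ ∧
        ∀ δ : ℝ, 0 ≤ δ → δ ≤ Δ →
          GoodCase.HasGoodCaseLatency (GoodCase.thirdBB f L Δ BA) L f δ δ (Δ + δ)) ∧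
    (n = 3 * f → Nontrivial V →
      ∀ {D : Type*} (Q : GoodCase.Protocol n D (Option V) (Option V)),
        GoodCase.SolvesBRB Q L f Δ 0 →
          ∀ δ T : ℝ, 0 < δ → δ ≤ Δ → GoodCase.HasGoodCaseLatency Q L f δ 0 T → Δ + δ ≤ T) := by
  refine ⟨fun BA hBA => ⟨GoodCase.ThirdBB.solvesBB_thirdBB hΔ hf hBA, fun δ hδ hδΔ =>
    GoodCase.ThirdBB.hasGoodCaseLatency_thirdBB hΔ hδ hδΔ BA⟩, ?_⟩
  intro hn hV D Q hQ δ T hδ hδΔ hT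
  exact GoodCase.le_goodCaseLatency hn hQ hδ hδΔ hT
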